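/- Let $M$ be a smooth (Hausdorff, finite-dimensional) manifold with projection $\pi:TM\to M$, and let $A\subset TM$ be open and conic ($\lambda v\in A$ for all $v\in A$, $\lambda>0$) with $\pi(A)=M$. All objects below are $C^\infty$. An $A$-anisotropic tensor field $T\in\mathcal T^r_s(M_A)$ assigns smoothly to each $v\in A$ an $(r,s)$-tensor $T_v$ on $T_{\pi(v)}M$, viewed as a multilinear function of $r$ covectors and $s$ vectors. An $A$-anisotropic connection is a map $\nabla:\mathfrak X(M)\times\mathfrak X(M)\to\mathcal T^1_0(M_A)$ that is additive in the second variable, satisfies $\nabla_X(fY)=(X(f)\,Y)\circ\pi+(f\circ\pi)\nabla_XY$, and is $C^\infty(M)$-linear in the first variable. Its Christoffel symbols in coordinates $x^i$ are given by $(\nabla_{\partial_i}\partial_j)_v=\Gamma^k_{ij}(v)\,\partial_k$. With $(x,y)$ the induced coordinates on $TM$, the covariant derivative of $T$ at $v\in A$ in the direction $u=u^k\partial_k\in T_{\pi(v)}M$ is the tensor $(\nabla_uT)_v$ on $T_{\pi(v)}M$ with components $$u^k\Big(\partial_{x^k}T^{a_1\dots a_r}_{b_1\dots b_s}-\Gamma^i_{kj}y^j\,\partial_{y^i}T^{a_1\dots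 a_r}_{b_1\dots b_s}+\sum_{l=1}^r\Gamma^{a_l}_{kj}T^{a_1\dots j\dots a_r}_{b_1\dots b_s}-\sum_{l=1}^s\Gamma^{i}_{kb_l}T^{a_1\dots a_r}_{b_1\dots i\dots b_s}\Big)(v).$$ Let $\gamma:[a,b]\to M$, $a<b$, be a regular curve (smooth with $\dot\gamma\neq0$ everywhere). For a field $W$ along $\gamma$ with values in $A$, the covariant derivative of a field $X$ along $\gamma$ with reference $W$ is $D^W_\gamma X=(\dot X^i+\Gamma^i_{jk}(W)\,\dot\gamma^jX^k)\,\partial_i$. For $v\in A\cap T_{\gamma(t_1)}M$ let $V$ be the $A$-valued field along $\gamma$ with $D^V_\gamma V=0$, $V(t_1)=v$; where it is defined, put $P_{t_1,t_2}(v)=V(t_2)$, and let $P^v_{t_1,t_2}:T_{\gamma(t_1)}M\to T_{\gamma(t_2)}M$ send $w$ to $Z(t_2)$, where $D^V_\gamma Z=0$ and $Z(t_1)=w$. Covectors are transported by $P^v_{t_1,t_2}(\theta)=\theta\circ P^{P_{t_1,t_2}(v)}_{t_2,t_1}$. For $v\in A\cap T_{\gamma(a)}M$ and $t\ge a$ close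 to $a$, let $P_t(T)_v$ be the $(r,s)$-tensor on $T_{\gamma(a)}M$ $$P_t(T)_v(\theta^1,\dots,\theta^r,w_1,\dots,w_s)=T_{P_{a,t}(v)}\big(P^v_{a,t}(\theta^1),\dots,P^v_{a,t}(\theta^r),P^v_{a,t}(w_1),\dots,P^v_{a,t}(w_s)\big).$$ Then for every $A$-anisotropic tensor field $T\in\mathcal T^r_s(M_A)$, every $A$-anisotropic connection $\nabla$, every regular curve $\gamma:[a,b]\to M$ and every $v\in A\cap T_{\gamma(a)}M$, the curve $t\mapsto P_t(T)_v$ in the vector space of $(r,s)$-tensors on $T_{\gamma(a)}M$ is (one-sidedly) differentiable at $t=a$ and $$(\nabla_{\dot\gamma(a)}T)_v=\frac{d}{dt}P_t(T)_v\Big|_{t=a}.$$ -/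

import Mathlib

open Set Bundle
open scoped Manifold ContDiff Topology

noncomputable section

/-! ### Tensors of type `(r, s)` on a real topological vector space -/

/-- The argument slots of an `(r, s)`-tensor on `F`: `r` covectors followed by `s` vectors. -/
def TensorSlot (F : Type*) [AddCommGroup F] [Module ℝ F] [TopologicalSpace F] (r s : ℕ) :
    Fin r ⊕ Fin s → Type _
  | Sum.inl _ => F →L[ℝ] ℝ
  | Sum.inr _ => F

section Tensor

variable {F G : Type*}
  [AddCommGroup F] [Module ℝ F] [TopologicalSpace F]
  [AddCommGroup G] [Module ℝ G] [TopologicalSpace G]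
  {r s : ℕ}

instance TensorSlot.instAddCommGroup : ∀ i, AddCommGroup (TensorSlot F r s i)
  | Sum.inl _ => inferInstanceAs (AddCommGroup (F →L[ℝ] ℝ))
  | Sum.inr _ => inferInstanceAs (AddCommGroup F)

instance TensorSlot.instModule : ∀ i, Module ℝ (TensorSlot F r s i)
  | Sum.inl _ => inferInstanceAs (Module ℝ (F →L[ℝ] ℝ))
  | Sum.inr _ => inferInstanceAs (Module ℝ F)

instance TensorSlot.instTopologicalSpace : ∀ i, TopologicalSpace (TensorSlot F r s i)
  | Sum.inl _ => inferInstanceAs (TopologicalSpace (F →L[ℝ] ℝ))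
  | Sum.inr _ => inferInstanceAs (TopologicalSpace F)

instance TensorSlot.instContinuousSMul [ContinuousSMul ℝ F] :
    ∀ i, ContinuousSMul ℝ (TensorSlot F r s i)
  | Sum.inl _ => inferInstanceAs (ContinuousSMul ℝ (F →L[ℝ] ℝ))
  | Sum.inr _ => inferInstanceAs (ContinuousSMul ℝ F)

variable (F r s) in
/-- Tensors of type `(r, s)` on `F`: real multilinear functions of `r` covectors and `s` vectors. -/
abbrev Tensor : Type _ := ContinuousMultilinearMap ℝ (TensorSlot F r s) ℝ

/-- The maps induced on the slots by `f : F → G` (acting on vectors) and `g : G → F` (acting on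
covectors by precomposition). -/
def slotMap (f : F →L[ℝ] G) (g : G →L[ℝ] F) :
    ∀ i : Fin r ⊕ Fin s, TensorSlot F r s i →L[ℝ] TensorSlot G r s i
  | Sum.inl _ => ContinuousLinearMap.precomp ℝ g
  | Sum.inr _ => f

/-- The tensor `(θ¹, …, θʳ, w₁, …, wₛ) ↦ T (θ¹ ∘ g, …, θʳ ∘ g, f w₁, …, f wₛ)`. -/
def Tensor.pull (f : F →L[ℝ] G) (g : G →L[ℝ] F) (T : Tensor G r s) : Tensor F r s :=
  ContinuousMultilinearMap.compContinuousLinearMap T (slotMap f g)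

/-- The action of an endomorphism `L` on the slots as a derivation commuting with contractions:
`w ↦ L w` on vectors and `θ ↦ -θ ∘ L` on covectors. -/
def slotDerivation [IsTopologicalAddGroup F] (L : F →L[ℝ] F) :
    ∀ i : Fin r ⊕ Fin s, TensorSlot F r s i →L[ℝ] TensorSlot F r s i
  | Sum.inl _ => -(ContinuousLinearMap.precomp ℝ L : (F →L[ℝ] ℝ) →L[ℝ] (F →L[ℝ] ℝ))
  | Sum.inr _ => L

/-- `∑ₖ T (θ¹, …, -θᵏ ∘ L, …, wₛ) + ∑ₗ T (θ¹, …, L wₗ, …, wₛ)`. -/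
def Tensor.derivationTerm [IsTopologicalAddGroup F] (L : F →L[ℝ] F) (T : Tensor F r s) :
    Tensor F r s :=
  ∑ i, ContinuousMultilinearMap.compContinuousLinearMap T
    (Function.update (fun j => ContinuousLinearMap.id ℝ (TensorSlot F r s j)) i
      (slotDerivation L i))

end Tensor

section Manifold

variable {E : Type*} [NormedAddCommGroup E] [NormedSpace ℝ E]
  {M : Type*} [TopologicalSpace M] [ChartedSpace E M]

/-! ### Vector fields -/

variable (E M) in
/-- `𝔛(M)`: smooth vector fields on `M`. -/
abbrev VField [IsManifold 𝓘(ℝ, E) ∞ M] : Type _ :=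
  ContMDiffSection 𝓘(ℝ, E) E ∞ (TangentSpace 𝓘(ℝ, E) : M → Type _)

/-- The product of a smooth function and a smooth vector field. -/
def VField.mulFun [IsManifold 𝓘(ℝ, E) ∞ M] (f : C^∞⟮𝓘(ℝ, E), M; ℝ⟯) (X : VField E M) :
    VField E M :=
  ⟨fun p => f p • X p, f.contMDiff.smul_section X.contMDiff⟩

/-- The derivative `X_p(f)` of a smooth function `f` in the direction of the vector `X_p`. -/
def dirDeriv (f : C^∞⟮𝓘(ℝ, E), M; ℝ⟯) {p : M} (u : TangentSpace 𝓘(ℝ, E) p) : ℝ :=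
  NormedSpace.fromTangentSpace (f p) (mfderiv 𝓘(ℝ, E) 𝓘(ℝ) f p u)

lemma dirDeriv_const (c : ℝ) {p : M} (u : TangentSpace 𝓘(ℝ, E) p) :
    dirDeriv (ContMDiffMap.const c) u = 0 := by
  have h : mfderiv 𝓘(ℝ, E) 𝓘(ℝ) (ContMDiffMap.const c : C^∞⟮𝓘(ℝ, E), M; ℝ⟯) p = 0 :=
    mfderiv_const
  rw [dirDeriv, h]
  exact map_zero (NormedSpace.fromTangentSpace (𝕜 := ℝ) (E := ℝ) _)

variable [IsManifold 𝓘(ℝ, E) ∞ M]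

/-- The vector at `q` with the same natural coordinates around `p` as `w ∈ T_p M`. -/
def constField {p : M} (w : TangentSpace 𝓘(ℝ, E) p) (q : M) : TangentSpace 𝓘(ℝ, E) q :=
  (trivializationAt E (TangentSpace 𝓘(ℝ, E)) p).symmL ℝ q
    ((trivializationAt E (TangentSpace 𝓘(ℝ, E)) p).continuousLinearMapAt ℝ p w)

lemma contMDiffOn_constField {p : M} (w : TangentSpace 𝓘(ℝ, E) p) :
    ContMDiffOn 𝓘(ℝ, E) 𝓘(ℝ, E).tangent ∞
      (fun q => (⟨q, constField w q⟩ : TangentBundle 𝓘(ℝ, E) M)) (chartAt E p).source := by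
  have key : ∀ y ∈ (chartAt E p).source,
      (trivializationAt E (TangentSpace 𝓘(ℝ, E)) p ⟨y, constField w y⟩).2 =
        (trivializationAt E (TangentSpace 𝓘(ℝ, E)) p).continuousLinearMapAt ℝ p w := by
    intro y hy
    have hy' : y ∈ (trivializationAt E (TangentSpace 𝓘(ℝ, E)) p).baseSet := hy
    rw [constField, Bundle.Trivialization.symmL_apply, Bundle.Trivialization.apply_mk_symm]
    all_goals exact hy'
  intro x hx
  have hx' : x ∈ (trivializationAt E (TangentSpace 𝓘(ℝ, E)) p).baseSet := hx
  exact ((trivializationAt E (TangentSpace 𝓘(ℝ, E)) p).contMDiffWithinAt_section _ hx').2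
    (contMDiffWithinAt_const.congr key (key x hx))

variable [FiniteDimensional ℝ E] [T2Space M]

/-- A smooth vector field on `M` which near `p` is the field with constant coefficients, in the
natural coordinates around `p`, whose value at `p` is `w` (it is cut off by a bump function). -/
def coordExt {p : M} (w : TangentSpace 𝓘(ℝ, E) p) : VField E M :=
  ⟨(Classical.arbitrary (SmoothBumpFunction 𝓘(ℝ, E) p) : M → ℝ) • constField w,
    ContMDiffOn.smul_section_of_tsupport
      (SmoothBumpFunction.contMDiff _).contMDiffOn (chartAt E p).open_source
      (SmoothBumpFunction.tsupport_subset_chartAt_source _) (contMDiffOn_constField w)⟩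

lemma coordExt_add {p : M} (w w' : TangentSpace 𝓘(ℝ, E) p) :
    coordExt (w + w') = coordExt w + coordExt w' := by
  ext q
  change (Classical.arbitrary (SmoothBumpFunction 𝓘(ℝ, E) p) q : ℝ) • constField (w + w') q =
    (Classical.arbitrary (SmoothBumpFunction 𝓘(ℝ, E) p) q : ℝ) • constField w q +
    (Classical.arbitrary (SmoothBumpFunction 𝓘(ℝ, E) p) q : ℝ) • constField w' q
  simp only [constField, map_add, smul_add]

lemma coordExt_smul {p : M} (c : ℝ) (w : TangentSpace 𝓘(ℝ, E) p) :
    coordExt (c • w) = VField.mulFun (ContMDiffMap.const c) (coordExt w) := by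
  ext q
  change (Classical.arbitrary (SmoothBumpFunction 𝓘(ℝ, E) p) q : ℝ) • constField (c • w) q =
    c • ((Classical.arbitrary (SmoothBumpFunction 𝓘(ℝ, E) p) q : ℝ) • constField w q)
  simp only [constField, map_smul]
  rw [smul_comm]

/-! ### Anisotropic tensor fields and anisotropic connections

`A` is a subset of `TM`. Objects over `A` are functions on `TM` of which only the values on `A`
matter. -/

/-- The coordinate representation of a tensor at `q` in the natural coordinates around `x`. -/
def Tensor.inChart {r s : ℕ} (x : M) {q : M} (T : Tensor (TangentSpace 𝓘(ℝ, E) q) r s) :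
    Tensor E r s :=
  T.pull ((trivializationAt E (TangentSpace 𝓘(ℝ, E)) x).symmL ℝ q)
    ((trivializationAt E (TangentSpace 𝓘(ℝ, E)) x).continuousLinearMapAt ℝ q)

/-- An `A`-anisotropic tensor field of type `(r, s)`: a tensor on `T_{π(v)}M` for each `v ∈ A`,
whose components in natural coordinates are smooth functions of `v`. -/
structure AnisotropicTensor (A : Set (TangentBundle 𝓘(ℝ, E) M)) (r s : ℕ) where
  toFun : ∀ v : TangentBundle 𝓘(ℝ, E) M, Tensor (TangentSpace 𝓘(ℝ, E) v.proj) r s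
  smooth : ∀ (x : M) (m : ∀ i, TensorSlot E r s i),
    ContMDiffOn 𝓘(ℝ, E).tangent 𝓘(ℝ) ∞ (fun v => (toFun v).inChart x m)
      (A ∩ {v | v.proj ∈ (chartAt E x).source})

/-- An `A`-anisotropic connection `(X, Y) ↦ ∇_X Y`; here `∇.toFun X Y v` is `(∇_X Y)_v`. -/
structure AnisotropicConnection (A : Set (TangentBundle 𝓘(ℝ, E) M)) where
  toFun : VField E M → VField E M → ∀ v : TangentBundle 𝓘(ℝ, E) M, TangentSpace 𝓘(ℝ, E) v.proj
  smooth : ∀ X Y : VField E M, ContMDiffOn 𝓘(ℝ, E).tangent 𝓘(ℝ, E).tangent ∞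
    (fun v => (⟨v.proj, toFun X Y v⟩ : TangentBundle 𝓘(ℝ, E) M)) A
  add_right : ∀ X Y Z : VField E M, ∀ v ∈ A, toFun X (Y + Z) v = toFun X Y v + toFun X Z v
  leibniz : ∀ (f : C^∞⟮𝓘(ℝ, E), M; ℝ⟯) (X Y : VField E M), ∀ v ∈ A,
    toFun X (VField.mulFun f Y) v =
      dirDeriv f (X v.proj) • Y v.proj + f v.proj • toFun X Y v
  linear_left : ∀ (f h : C^∞⟮𝓘(ℝ, E), M; ℝ⟯) (X Y Z : VField E M), ∀ v ∈ A,
    toFun (VField.mulFun f X + VField.mulFun h Y) Z v =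
      f v.proj • toFun X Z v + h v.proj • toFun Y Z v

namespace AnisotropicConnection

variable {A : Set (TangentBundle 𝓘(ℝ, E) M)} (nabla : AnisotropicConnection A)

/-- The Christoffel symbols at `v ∈ T_p M` in the natural coordinates around `p`, as the bilinear
expression `uⁱ wʲ Γᵏᵢⱼ(v) ∂ₖ`, that is, `∇` of coordinate fields with constant coefficients. -/
def christoffel {p : M} (v u w : TangentSpace 𝓘(ℝ, E) p) : TangentSpace 𝓘(ℝ, E) p :=
  nabla.toFun (coordExt u) (coordExt w) ⟨p, v⟩

/-- `w ↦ Γ_v(u, w)` as a linear map. -/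
def christoffelMap {p : M} (v : TangentSpace 𝓘(ℝ, E) p)
    (hv : (⟨p, v⟩ : TangentBundle 𝓘(ℝ, E) M) ∈ A) (u : TangentSpace 𝓘(ℝ, E) p) :
    TangentSpace 𝓘(ℝ, E) p →L[ℝ] TangentSpace 𝓘(ℝ, E) p :=
  haveI : FiniteDimensional ℝ (TangentSpace 𝓘(ℝ, E) p) := inferInstanceAs (FiniteDimensional ℝ E)
  haveI : T2Space (TangentSpace 𝓘(ℝ, E) p) := inferInstanceAs (T2Space E)
  LinearMap.toContinuousLinearMap
    { toFun := fun w => nabla.christoffel v u w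
      map_add' := fun w w' => by
        simp only [christoffel, coordExt_add, nabla.add_right _ _ _ _ hv]
      map_smul' := fun c w => by
        simp only [christoffel, coordExt_smul, nabla.leibniz _ _ _ _ hv, RingHom.id_apply]
        rw [dirDeriv_const, zero_smul, zero_add]
        rfl }

/-! ### Covariant derivative of anisotropic tensors -/

/-- The point with coordinates `x(p) + τ u` in the chart around `p`. -/
def chartLine {p : M} (u : TangentSpace 𝓘(ℝ, E) p) (τ : ℝ) : M :=
  (extChartAt 𝓘(ℝ, E) p).symm (extChartAt 𝓘(ℝ, E) p p +
    τ • (trivializationAt E (TangentSpace 𝓘(ℝ, E)) p).continuousLinearMapAt ℝ p u)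

/-- The covariant derivative `(∇_u T)_v`, `v ∈ A ∩ T_p M`, `u ∈ T_p M`. In the natural coordinates
`(x, y)` around `p` its components are
`uᵏ (∂_{xᵏ} T - Γⁱₖⱼ yʲ ∂_{yⁱ} T + ∑ Γ^{a_l}ₖⱼ T^{… j …} - ∑ Γⁱ_{k b_l} T_{… i …})`,
all evaluated at `v`. -/
def covDeriv {r s : ℕ} (T : AnisotropicTensor A r s) {p : M} (v : TangentSpace 𝓘(ℝ, E) p)
    (hv : (⟨p, v⟩ : TangentBundle 𝓘(ℝ, E) M) ∈ A) (u : TangentSpace 𝓘(ℝ, E) p) :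
    Tensor (TangentSpace 𝓘(ℝ, E) p) r s :=
  -- horizontal part: derivative of the components at `(x(p) + τ u, y(v))`
  Tensor.pull ((trivializationAt E (TangentSpace 𝓘(ℝ, E)) p).continuousLinearMapAt ℝ p)
      ((trivializationAt E (TangentSpace 𝓘(ℝ, E)) p).symmL ℝ p)
      (deriv (fun τ : ℝ =>
        (T.toFun ⟨chartLine u τ, constField v (chartLine u τ)⟩).inChart p) 0)
    -- vertical derivative in the direction `Γ_v(u, v)`
    - deriv (fun τ : ℝ => T.toFun ⟨p, v + τ • nabla.christoffel v u v⟩) 0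
    - (T.toFun ⟨p, v⟩).derivationTerm (nabla.christoffelMap v hv u)

/-! ### Covariant derivative and parallel transport along a curve `γ : [a, b] → M` -/

variable (E) in
/-- The velocity of `γ : [a, b] → M` (one-sided at the ends). -/
def velocity (γ : ℝ → M) (a b t : ℝ) : TangentSpace 𝓘(ℝ, E) (γ t) :=
  mfderivWithin 𝓘(ℝ) 𝓘(ℝ, E) γ (Icc a b) t (1 : ℝ)

/-- The covariant derivative `D_γ^v X` at the instant `t` of a field `X` along `γ : [a, b] → M`,
with reference vector `v ∈ T_{γ(t)} M`: in the natural coordinates around `γ(t)` it is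
`(Ẋⁱ + Γⁱⱼₖ(v) γ̇ʲ Xᵏ) ∂ᵢ`. -/
def covDerivAlong (γ : ℝ → M) (a b : ℝ) (X : ∀ t, TangentSpace 𝓘(ℝ, E) (γ t)) (t : ℝ)
    (v : TangentSpace 𝓘(ℝ, E) (γ t)) : TangentSpace 𝓘(ℝ, E) (γ t) :=
  (trivializationAt E (TangentSpace 𝓘(ℝ, E)) (γ t)).symmL ℝ (γ t)
      (derivWithin
        (fun τ => (trivializationAt E (TangentSpace 𝓘(ℝ, E)) (γ t) ⟨γ τ, X τ⟩).2) (Icc a b) t)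
    + nabla.christoffel v (velocity E γ a b t) (X t)

/-- `X` is smooth and `D_γ^W X = 0` on the subset `J` of `[a, b]`. -/
structure IsParallelOn (γ : ℝ → M) (a b : ℝ) (J : Set ℝ)
    (W X : ∀ t, TangentSpace 𝓘(ℝ, E) (γ t)) : Prop where
  smooth : ContMDiffOn 𝓘(ℝ) 𝓘(ℝ, E).tangent ∞
    (fun t => (⟨γ t, X t⟩ : TangentBundle 𝓘(ℝ, E) M)) J
  parallel : ∀ t ∈ J, nabla.covDerivAlong γ a b X t (W t) = 0

/-- `V` is an `A`-admissible field with `D_γ^V V = 0` on `J`. -/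
structure IsParallelObserverOn (γ : ℝ → M) (a b : ℝ) (J : Set ℝ)
    (V : ∀ t, TangentSpace 𝓘(ℝ, E) (γ t)) : Prop where
  admissible : ∀ t ∈ J, (⟨γ t, V t⟩ : TangentBundle 𝓘(ℝ, E) M) ∈ A
  parallel : nabla.IsParallelOn γ a b J V V

/-- `J` is a relatively open subinterval of `[a, b]` containing `t₁` and `t₂`. -/
structure IsTransportInterval (a b : ℝ) (J : Set ℝ) (t₁ t₂ : ℝ) : Prop where
  subset : J ⊆ Icc a b
  ordConnected : J.OrdConnected
  mem_nhdsWithin : ∀ t ∈ J, J ∈ 𝓝[Icc a b] t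
  left_mem : t₁ ∈ J
  right_mem : t₂ ∈ J

open Classical in
/-- The instantaneous observer's parallel transport `P_{t₁,t₂}(v) = V(t₂)`, where `V(t₁) = v` and
`D_γ^V V = 0` (zero if there is no such `V` between `t₁` and `t₂`). -/
def observerTransport (γ : ℝ → M) (a b t₁ t₂ : ℝ) (v : TangentSpace 𝓘(ℝ, E) (γ t₁)) :
    TangentSpace 𝓘(ℝ, E) (γ t₂) :=
  if h : ∃ V : ∀ t, TangentSpace 𝓘(ℝ, E) (γ t), V t₁ = v ∧
      ∃ J, IsTransportInterval a b J t₁ t₂ ∧ nabla.IsParallelObserverOn γ a b J V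
  then h.choose t₂ else 0

/-- `W` is a field along `γ` from `t₁` to `t₂` with `D_γ^V W = 0`, where `V` is the parallel observer
with `V(t₁) = v`. -/
def IsParallelWrtObserver (γ : ℝ → M) (a b t₁ t₂ : ℝ) (v : TangentSpace 𝓘(ℝ, E) (γ t₁))
    (W : ∀ t, TangentSpace 𝓘(ℝ, E) (γ t)) : Prop :=
  ∃ (J : Set ℝ) (V : ∀ t, TangentSpace 𝓘(ℝ, E) (γ t)), IsTransportInterval a b J t₁ t₂ ∧
    V t₁ = v ∧ nabla.IsParallelObserverOn γ a b J V ∧ nabla.IsParallelOn γ a b J V W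

open Classical in
/-- The parallel transport `P^v_{t₁,t₂}` with respect to the observer `v`: the linear map sending
each `w` to `W(t₂)`, where `W(t₁) = w`, `D_γ^V W = 0` and `V` is the parallel observer with
`V(t₁) = v` (zero if `V` does not reach `t₂`). -/
def transport (γ : ℝ → M) (a b t₁ t₂ : ℝ) (v : TangentSpace 𝓘(ℝ, E) (γ t₁)) :
    TangentSpace 𝓘(ℝ, E) (γ t₁) →L[ℝ] TangentSpace 𝓘(ℝ, E) (γ t₂) :=
  if h : ∃ L : TangentSpace 𝓘(ℝ, E) (γ t₁) →L[ℝ] TangentSpace 𝓘(ℝ, E) (γ t₂),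
      ∀ w, ∃ W : ∀ t, TangentSpace 𝓘(ℝ, E) (γ t),
        nabla.IsParallelWrtObserver γ a b t₁ t₂ v W ∧ W t₁ = w ∧ W t₂ = L w
  then h.choose else 0

/-- The parallel transport of an anisotropic tensor,
`P_{t₁,t₂}(T)_v (θ, …, w, …) = T_{P_{t₂,t₁}(v)} (P^v_{t₂,t₁} θ, …, P^v_{t₂,t₁} w, …)` for
`v ∈ T_{γ(t₂)} M`. A covector `θ` at `γ(t₂)` is transported to `γ(t₁)` as `θ` composed with the
transport of vectors from `γ(t₁)` back to `γ(t₂)` with respect to the same parallel observer. -/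
def tensorTransport {r s : ℕ} (T : AnisotropicTensor A r s) (γ : ℝ → M) (a b t₁ t₂ : ℝ)
    (v : TangentSpace 𝓘(ℝ, E) (γ t₂)) : Tensor (TangentSpace 𝓘(ℝ, E) (γ t₂)) r s :=
  Tensor.pull (nabla.transport γ a b t₂ t₁ v)
    (nabla.transport γ a b t₁ t₂ (nabla.observerTransport γ a b t₂ t₁ v))
    (T.toFun ⟨γ t₁, nabla.observerTransport γ a b t₂ t₁ v⟩)

end AnisotropicConnection

end Manifold

end

noncomputable section

/-! ### Differentiation of curves of tensors -/

section TensorCalculus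

variable {F : Type*} [AddCommGroup F] [Module ℝ F] [TopologicalSpace F] {r s : ℕ}

/-! In the natural coordinates of the single chart around γ(a), the parallel observer V and the
fields Z parallel with respect to it satisfy V' = -Γ_V(γ̇, V) and Z' = -Γ_V(γ̇, Z): the same linear
expression, with coefficients evaluated at V. One equation therefore governs both. Let y be the
coordinates of v and let Φ solve Φ' = -Γ_{Φy}(γ̇, Φ ·), Φ(a) = 1, in End(E). Then Φ(t)y is the
observer, Φ(t)w is the transport of w, covectors move by θ ↦ θ ∘ Φ(t)⁻¹, and P_t(T)_v(θ, w) is T at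
(x(γ(t)), Φ(t)y) evaluated on (θ ∘ Φ(t)⁻¹, Φ(t)w).

Put B = Γ_v(γ̇(a), ·), so that Φ'(a) = -B and (Φ⁻¹)'(a) = B. The product rule at t = a yields the
derivative of the components of T in the horizontal direction γ̇(a), their derivative in the
vertical direction -By, a term with θ ∘ B for each covector slot and a term with -Bw for each vector
slot. These are the terms of the coordinate formula for (∇_{γ̇(a)}T)_v.

Three points carry the argument. The derivative D_γ is defined at each instant in the chart centred
at γ(t), and must be expressed in the fixed chart (`covDerivAlong_eq_coord`); this goes through the
invariance of ∇ (`toFun_eq_covDerivAlong`) rather than a transformation law for Christoffel symbols.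
The frame Φ exists for a short time (`exists_isParallelFrame`), and uniqueness for the differential
equations identifies the transports with it (`observerTransport_eq`, `transport_eq`). Finally,
tangent spaces carry a topology but no chosen norm, so curves of tensors are differentiated
componentwise (`Tensor.hasDerivWithinAt_iff`, `Tensor.deriv_apply`). -/

lemma finite_tensorSlot [ContinuousSMul ℝ F] [FiniteDimensional ℝ F] :
    ∀ i, Module.Finite ℝ (TensorSlot F r s i)
  | Sum.inl _ => Module.Finite.of_injective
      (ContinuousLinearMap.coeLM ℝ : (F →L[ℝ] ℝ) →ₗ[ℝ] (F →ₗ[ℝ] ℝ))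
      ContinuousLinearMap.coe_injective
  | Sum.inr _ => inferInstanceAs (Module.Finite ℝ F)

lemma finite_tensor [ContinuousSMul ℝ F] [FiniteDimensional ℝ F] :
    Module.Finite ℝ (Tensor F r s) := by
  have := finite_tensorSlot (F := F) (r := r) (s := s)
  exact Module.Finite.of_injective
    (ContinuousMultilinearMap.toMultilinearMapLinear :
      Tensor F r s →ₗ[ℝ] MultilinearMap ℝ (TensorSlot F r s) ℝ)
    ContinuousMultilinearMap.toMultilinearMap_injective

variable (F r s) in
/-- A tensor as the family of its values. -/
def Tensor.evalL [ContinuousSMul ℝ F] :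
    Tensor F r s →L[ℝ] ((∀ i, TensorSlot F r s i) → ℝ) :=
  ContinuousLinearMap.pi fun m => ContinuousMultilinearMap.apply ℝ (TensorSlot F r s) ℝ m

/-- An injective linear map from a finite-dimensional space into a Hausdorff one is a closed
embedding. Inducing the topology lets differentiability be tested on components; closedness of the
range makes a pointwise limit of tensors a tensor. -/
lemma Tensor.isClosedEmbedding_evalL [ContinuousSMul ℝ F] [FiniteDimensional ℝ F] :
    Topology.IsClosedEmbedding (Tensor.evalL F r s) := by
  have := finite_tensor (F := F) (r := r) (s := s)
  refine LinearMap.isClosedEmbedding_of_injective (f := (Tensor.evalL F r s).toLinearMap) ?_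
  rw [LinearMap.ker_eq_bot]
  intro T T' h
  ext m
  exact congrFun h m

/-- A curve of tensors is differentiable iff all its components are. -/
lemma Tensor.hasDerivWithinAt_iff [ContinuousSMul ℝ F] [FiniteDimensional ℝ F]
    {f : ℝ → Tensor F r s} {f' : Tensor F r s} {S : Set ℝ} {t : ℝ} :
    HasDerivWithinAt f f' S t ↔ ∀ m, HasDerivWithinAt (fun τ => f τ m) (f' m) S t := by
  have h := (Tensor.evalL F r s).isThetaTVS_comp (𝕜 := ℝ) (l := 𝓝[S] t ×ˢ pure t)
    (f := fun p : ℝ × ℝ => f p.1 - f p.2 - ContinuousLinearMap.toSpanSingleton ℝ f' (p.1 - p.2))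
    Tensor.isClosedEmbedding_evalL.isInducing
  constructor
  · intro H m
    have H1 := h.trans_isLittleOTVS ((hasFDerivAtFilter_iff_isLittleOTVS _ _ _).1 H)
    exact (hasFDerivAtFilter_iff_isLittleOTVS _ _ _).2 (H1.proj m)
  · intro H
    refine (hasFDerivAtFilter_iff_isLittleOTVS _ _ _).2 (h.symm.trans_isLittleOTVS ?_)
    exact Asymptotics.IsLittleOTVS.pi fun m => (hasFDerivAtFilter_iff_isLittleOTVS _ _ _).1 (H m)

lemma Tensor.hasDerivAt_iff [ContinuousSMul ℝ F] [FiniteDimensional ℝ F]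
    {f : ℝ → Tensor F r s} {f' : Tensor F r s} {t : ℝ} :
    HasDerivAt f f' t ↔ ∀ m, HasDerivAt (fun τ => f τ m) (f' m) t := by
  have h := Tensor.hasDerivWithinAt_iff (f := f) (f' := f') (S := univ) (t := t)
  simpa only [HasDerivWithinAt, HasDerivAt, nhdsWithin_univ] using! h

/-- The derivative of a curve of tensors is computed componentwise. -/
lemma Tensor.deriv_apply [ContinuousSMul ℝ F] [FiniteDimensional ℝ F]
    {f : ℝ → Tensor F r s} {t : ℝ} {φ : (∀ i, TensorSlot F r s i) → ℝ}
    (h : ∀ m, HasDerivAt (fun τ => f τ m) (φ m) t) (m : ∀ i, TensorSlot F r s i) :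
    deriv f t m = φ m := by
  -- The family φ of componentwise derivatives is not assumed multilinear. It is a limit of
  -- difference quotients, which are tensors, hence lies in the closed range of `evalL`.
  obtain ⟨T, hT⟩ : φ ∈ range (Tensor.evalL F r s) := by
    refine Tensor.isClosedEmbedding_evalL.isClosed_range.mem_of_tendsto
      (b := 𝓝[≠] t) (f := fun τ => Tensor.evalL F r s ((τ - t)⁻¹ • (f τ - f t)))
      (tendsto_pi_nhds.2 fun m => ?_) (Filter.Eventually.of_forall fun τ => mem_range_self _)
    exact hasDerivAt_iff_tendsto_slope.1 (h m)
  have hd : HasDerivAt f T t := Tensor.hasDerivAt_iff.2 fun m => by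
    have : T m = φ m := congrFun hT m
    rw [this]
    exact h m
  -- Here `deriv` is unfolded as `fderiv` applied to 1; the comparison with φ then takes place on
  -- real components, where derivatives are unique.
  have hd' : HasDerivAt f (deriv f t) t := by
    have := (HasFDerivAt.differentiableAt (h := hd)).hasFDerivAt
    have e : fderiv ℝ f t = ContinuousLinearMap.toSpanSingleton ℝ (deriv f t) := by
      ext
      simp [deriv]
    rw [e] at this
    exact this
  exact (Tensor.hasDerivAt_iff.1 hd' m).unique (h m)

/-! ### Product rule for evaluating a moving tensor on moving arguments -/

variable {E : Type*} [NormedAddCommGroup E] [NormedSpace ℝ E]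

/-- The inclusion of a slot into the product of the dual and the space. -/
def slotIncl : ∀ i : Fin r ⊕ Fin s, TensorSlot E r s i →L[ℝ] ((E →L[ℝ] ℝ) × E)
  | Sum.inl _ => ContinuousLinearMap.inl ℝ (E →L[ℝ] ℝ) E
  | Sum.inr _ => ContinuousLinearMap.inr ℝ (E →L[ℝ] ℝ) E

/-- The projection of the product of the dual and the space onto a slot. -/
def slotProj : ∀ i : Fin r ⊕ Fin s, ((E →L[ℝ] ℝ) × E) →L[ℝ] TensorSlot E r s i
  | Sum.inl _ => ContinuousLinearMap.fst ℝ (E →L[ℝ] ℝ) E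
  | Sum.inr _ => ContinuousLinearMap.snd ℝ (E →L[ℝ] ℝ) E

lemma slotProj_slotIncl : ∀ (i : Fin r ⊕ Fin s) (x : TensorSlot E r s i),
    slotProj i (slotIncl i x) = x
  | Sum.inl _, _ => rfl
  | Sum.inr _, _ => rfl

lemma slotIncl_hasDerivWithinAt {S : Set ℝ} {t : ℝ} : ∀ (i : Fin r ⊕ Fin s)
    {x : ℝ → TensorSlot E r s i} {x' : TensorSlot E r s i}, HasDerivWithinAt x x' S t →
    HasDerivWithinAt (fun τ => slotIncl i (x τ)) (slotIncl i x') S t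
  | Sum.inl _, _, _, h =>
    (ContinuousLinearMap.inl ℝ (E →L[ℝ] ℝ) E).hasFDerivAt.comp_hasDerivWithinAt t h
  | Sum.inr _, _, _, h =>
    (ContinuousLinearMap.inr ℝ (E →L[ℝ] ℝ) E).hasFDerivAt.comp_hasDerivWithinAt t h

/-- The product rule for the evaluation of a curve of tensors on curves of arguments, when the
slots are retracts of a normed space. -/
lemma Tensor.hasDerivWithinAt_apply_of_retract {K : Type*} [NormedAddCommGroup K]
    [NormedSpace ℝ K] [ContinuousSMul ℝ F] (inc : ∀ i, TensorSlot F r s i →L[ℝ] K)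
    (pr : ∀ i, K →L[ℝ] TensorSlot F r s i) (hpr : ∀ i x, pr i (inc i x) = x)
    {N : ℝ → Tensor F r s} {N' : Tensor F r s}
    {m : ℝ → ∀ i, TensorSlot F r s i} {m' : ∀ i, TensorSlot F r s i} {S : Set ℝ} {t : ℝ}
    (hN : HasDerivWithinAt N N' S t)
    (hm : ∀ i, HasDerivWithinAt (fun τ => inc i (m τ i)) (inc i (m' i)) S t) :
    HasDerivWithinAt (fun τ => N τ (m τ))
      (N' (m t) + ∑ i, N t (Function.update (m t) i (m' i))) S t := by
  -- Precomposition with the retractions replaces the slots of varying type by the one normed space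
  -- K, where the product rule for continuous multilinear maps applies.
  let L : Tensor F r s →L[ℝ] ContinuousMultilinearMap ℝ (fun _ : Fin r ⊕ Fin s => K) ℝ :=
    ContinuousMultilinearMap.compContinuousLinearMapL pr
  have hL : ∀ (T : Tensor F r s) (k : ∀ i, TensorSlot F r s i),
      L T (fun i => inc i (k i)) = T k := fun T k => by
    simp [L, hpr]
  have hN' : HasDerivWithinAt (fun τ => L (N τ)) (L N') S t := by
    refine (hasFDerivAtFilter_iff_isLittleOTVS _ _ _).2 <|
      ((L.isBigOTVS_comp (f := fun p : ℝ × ℝ =>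
        N p.1 - N p.2 - ContinuousLinearMap.toSpanSingleton ℝ N' (p.1 - p.2))).trans_isLittleOTVS
        ((hasFDerivAtFilter_iff_isLittleOTVS _ _ _).1 hN)).congr_left fun p => ?_
    simp
  have h := (HasFDerivWithinAt.continuousMultilinearMap_apply hN'.hasFDerivWithinAt
    (fun i => (hm i).hasFDerivWithinAt)).hasDerivWithinAt
  have hupd : ∀ i, Function.update (fun j => inc j (m t j)) i (inc i (m' i)) =
      fun j => inc j (Function.update (m t) i (m' i) j) := fun i => by
    ext1 j
    rcases eq_or_ne j i with rfl | hij <;> simp [*]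
  have hfun : (fun τ => N τ (m τ)) = fun τ => L (N τ) fun i => inc i (m τ i) :=
    funext fun τ => (hL _ _).symm
  rw [hfun]
  refine h.congr_deriv ?_
  rw [add_apply, sum_apply]
  congr 1
  · change ((1 : ℝ) • L N') _ = _
    rw [one_smul, hL]
  · refine Finset.sum_congr rfl fun i _ => ?_
    change L (N t) (Function.update _ i ((1 : ℝ) • inc i (m' i))) = _
    rw [one_smul, hupd, hL]

/-- The product rule for the evaluation of a curve of tensors on curves of arguments. -/
lemma Tensor.hasDerivWithinAt_apply
    {N : ℝ → Tensor E r s} {N' : Tensor E r s}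
    {m : ℝ → ∀ i, TensorSlot E r s i} {m' : ∀ i, TensorSlot E r s i} {S : Set ℝ} {t : ℝ}
    (hN : HasDerivWithinAt N N' S t) (hm : ∀ i, HasDerivWithinAt (fun τ => m τ i) (m' i) S t) :
    HasDerivWithinAt (fun τ => N τ (m τ))
      (N' (m t) + ∑ i, N t (Function.update (m t) i (m' i))) S t :=
  Tensor.hasDerivWithinAt_apply_of_retract slotIncl slotProj slotProj_slotIncl hN
    fun i => slotIncl_hasDerivWithinAt i (hm i)

end TensorCalculus
/-! ### Ordinary differential equations depending on a curve of parameters -/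

section ODEParam

variable {P Y : Type*} [NormedAddCommGroup P] [NormedSpace ℝ P]
  [NormedAddCommGroup Y] [NormedSpace ℝ Y]

/-- Two solutions of `ẏ = F (p(t), y)` on a compact interval which agree at one instant agree. -/
theorem ODE_param_unique {F : P × Y → Y} {p : ℝ → P} {y z : ℝ → Y} {α β t₀ : ℝ}
    (hp : ContinuousOn p (Icc α β)) (hF : ∀ t ∈ Icc α β, ContDiffAt ℝ 1 F (p t, y t))
    (hy : ∀ t ∈ Icc α β, HasDerivWithinAt y (F (p t, y t)) (Icc α β) t)
    (hz : ∀ t ∈ Icc α β, HasDerivWithinAt z (F (p t, z t)) (Icc α β) t)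
    (ht₀ : t₀ ∈ Icc α β) (h₀ : y t₀ = z t₀) : EqOn y z (Icc α β) := by
  have hyc : ContinuousOn y (Icc α β) := fun t ht => (hy t ht).continuousWithinAt
  have hzc : ContinuousOn z (Icc α β) := fun t ht => (hz t ht).continuousWithinAt
  let S : Set (Icc α β) := {t | y t = z t}
  have hclosed : IsClosed S := isClosed_eq hyc.domRestrict hzc.domRestrict
  -- Agreement at t₁ spreads to a relative neighbourhood: there both curves stay in a set U on which
  -- F is Lipschitz, and Grönwall uniqueness applies on each side of t₁. Connectedness of the
  -- interval then concludes.
  have hopen : IsOpen S := by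
    rw [isOpen_iff_mem_nhds]
    rintro ⟨t₁, ht₁⟩ (h₁ : y t₁ = z t₁)
    obtain ⟨K, U, hU, hlip⟩ := (hF t₁ ht₁).exists_lipschitzOnWith
    have hyU : ∀ᶠ t in 𝓝[Icc α β] t₁, (p t, y t) ∈ U :=
      ((hp t₁ ht₁).prodMk (hyc t₁ ht₁)).eventually hU
    have hzU : ∀ᶠ t in 𝓝[Icc α β] t₁, (p t, z t) ∈ U :=
      ((hp t₁ ht₁).prodMk (hzc t₁ ht₁)).eventually (by simpa only [← h₁] using! hU)
    obtain ⟨δ, hδ, hball⟩ := Metric.mem_nhdsWithin_iff.1 (hyU.and hzU)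
    have hlip' : ∀ t, LipschitzOnWith K (fun x => F (p t, x)) {x | (p t, x) ∈ U} := by
      intro t x hx x' hx'
      have := hlip hx hx'
      simpa [Prod.edist_eq] using this
    have main : ∀ᶠ t in 𝓝[Icc α β] t₁, y t = z t := by
      filter_upwards [self_mem_nhdsWithin, mem_nhdsWithin_of_mem_nhds (Metric.ball_mem_nhds t₁ hδ)]
        with t ht htδ
      have hmem : ∀ τ, τ ∈ uIcc t₁ t → τ ∈ Icc α β ∧ (p τ, y τ) ∈ U ∧ (p τ, z τ) ∈ U := by
        intro τ hτ
        have h1 : τ ∈ Icc α β := uIcc_subset_Icc ht₁ ht hτ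
        refine ⟨h1, hball ⟨?_, h1⟩⟩
        have : |τ - t₁| ≤ |t - t₁| := abs_sub_left_of_mem_uIcc hτ
        rw [Metric.mem_ball, Real.dist_eq] at htδ ⊢
        exact this.trans_lt htδ
      rcases le_total t₁ t with hle | hle
      · rw [uIcc_of_le hle] at hmem
        have hd : ∀ {x : ℝ → Y} {x' : Y} {τ : ℝ}, τ ∈ Ico t₁ t →
            HasDerivWithinAt x x' (Icc α β) τ → HasDerivWithinAt x x' (Ici τ) τ := by
          intro x x' τ hτ hx
          exact hx.mono_of_mem_nhdsWithin (Filter.mem_of_superset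
            (Icc_mem_nhdsGE (hτ.2.trans_le ht.2)) (Icc_subset_Icc_left (ht₁.1.trans hτ.1)))
        exact ODE_solution_unique_of_mem_Icc_right (v := fun t x => F (p t, x))
          (s := fun t => {x | (p t, x) ∈ U}) (fun τ _ => hlip' τ)
          (hyc.mono fun τ hτ => (hmem τ hτ).1)
          (fun τ hτ => hd hτ (hy τ (hmem τ (Ico_subset_Icc_self hτ)).1))
          (fun τ hτ => (hmem τ (Ico_subset_Icc_self hτ)).2.1)
          (hzc.mono fun τ hτ => (hmem τ hτ).1)
          (fun τ hτ => hd hτ (hz τ (hmem τ (Ico_subset_Icc_self hτ)).1))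
          (fun τ hτ => (hmem τ (Ico_subset_Icc_self hτ)).2.2) h₁ ⟨hle, le_rfl⟩
      · rw [uIcc_of_ge hle] at hmem
        have hd : ∀ {x : ℝ → Y} {x' : Y} {τ : ℝ}, τ ∈ Ioc t t₁ →
            HasDerivWithinAt x x' (Icc α β) τ → HasDerivWithinAt x x' (Iic τ) τ := by
          intro x x' τ hτ hx
          exact hx.mono_of_mem_nhdsWithin (Filter.mem_of_superset
            (Icc_mem_nhdsLE (ht.1.trans_lt hτ.1)) (Icc_subset_Icc_right (hτ.2.trans ht₁.2)))
        exact ODE_solution_unique_of_mem_Icc_left (v := fun t x => F (p t, x))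
          (s := fun t => {x | (p t, x) ∈ U}) (fun τ _ => hlip' τ)
          (hyc.mono fun τ hτ => (hmem τ hτ).1)
          (fun τ hτ => hd hτ (hy τ (hmem τ (Ioc_subset_Icc_self hτ)).1))
          (fun τ hτ => (hmem τ (Ioc_subset_Icc_self hτ)).2.1)
          (hzc.mono fun τ hτ => (hmem τ hτ).1)
          (fun τ hτ => hd hτ (hz τ (hmem τ (Ioc_subset_Icc_self hτ)).1))
          (fun τ hτ => (hmem τ (Ioc_subset_Icc_self hτ)).2.2) h₁ ⟨le_rfl, hle⟩
    rw [nhds_subtype_eq_comap_nhdsWithin]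
    exact Filter.preimage_mem_comap main
  have : PreconnectedSpace (Icc α β) := isPreconnected_iff_preconnectedSpace.1 isPreconnected_Icc
  have huniv : S = univ := IsClopen.eq_univ ⟨hclosed, hopen⟩ ⟨⟨t₀, ht₀⟩, h₀⟩
  intro t ht
  exact huniv.ge (mem_univ (⟨t, ht⟩ : Icc α β))

/-- Local existence of a smooth solution of `ẏ = F (p(t), y)` on an interval `[a, a + ε]`. -/
theorem ODE_param_exists [CompleteSpace Y] {F : P × Y → Y} {Ω : Set (P × Y)} (hΩ : IsOpen Ω)
    (hF : ContDiffOn ℝ ∞ F Ω) {p : ℝ → P} {a b : ℝ} (hab : a < b)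
    (hp : ContDiffOn ℝ ∞ p (Icc a b)) {y₀ : Y} (h₀ : (p a, y₀) ∈ Ω) :
    ∃ ε > 0, a + ε ≤ b ∧ ∃ y : ℝ → Y, y a = y₀ ∧ ContDiffOn ℝ ∞ y (Icc a (a + ε)) ∧
      ∀ t ∈ Icc a (a + ε), (p t, y t) ∈ Ω ∧
        HasDerivWithinAt y (F (p t, y t)) (Icc a (a + ε)) t := by
  have hFa : ContDiffAt ℝ 1 F (p a, y₀) :=
    (hF.contDiffAt (hΩ.mem_nhds h₀)).of_le (by exact_mod_cast le_top)
  obtain ⟨K, U, hU, hlip⟩ := hFa.exists_lipschitzOnWith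
  have hbd : ∀ᶠ z in 𝓝 (p a, y₀), ‖F z‖ < ‖F (p a, y₀)‖ + 1 :=
    hFa.continuousAt.norm.eventually_lt_const (lt_add_one _)
  obtain ⟨ρ, hρ, hball⟩ := Metric.nhds_basis_closedBall.mem_iff.1
    (Filter.inter_mem (Filter.inter_mem hU (hΩ.mem_nhds h₀)) hbd)
  have hgood : ∀ {q x}, q ∈ Metric.closedBall (p a) ρ → x ∈ Metric.closedBall y₀ ρ →
      ((q, x) ∈ U ∧ (q, x) ∈ Ω) ∧ ‖F (q, x)‖ < ‖F (p a, y₀)‖ + 1 := by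
    intro q x hq hx
    apply hball
    rw [← closedBall_prod_same]
    exact ⟨hq, hx⟩
  have hpc : ContinuousOn p (Icc a b) := hp.continuousOn
  have haI : a ∈ Icc a b := left_mem_Icc.2 hab.le
  obtain ⟨δ, hδ, hδp⟩ := Metric.mem_nhdsWithin_iff.1
    ((hpc a haI).eventually (Metric.closedBall_mem_nhds _ hρ))
  set L : ℝ := ‖F (p a, y₀)‖ + 1 with hL
  have hLpos : 0 < L := by positivity
  -- The three bounds keep the interval inside [a, b], keep p(t) in the ball of radius ρ, and
  -- prevent a curve of speed at most L from leaving the ball of radius ρ around y₀.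
  obtain ⟨ε₀, hε₀, hε₀b, hε₀δ, hε₀L⟩ : ∃ ε > 0, a + ε ≤ b ∧ ε < δ ∧ L * ε ≤ ρ := by
    refine ⟨min (b - a) (min (δ / 2) (ρ / L)), ?_, ?_, ?_, ?_⟩
    · exact lt_min (sub_pos.2 hab) (lt_min (half_pos hδ) (div_pos hρ hLpos))
    · linarith [min_le_left (b - a) (min (δ / 2) (ρ / L))]
    · have := (min_le_right (b - a) (min (δ / 2) (ρ / L))).trans (min_le_left _ _)
      linarith
    · have := (min_le_right (b - a) (min (δ / 2) (ρ / L))).trans (min_le_right _ _)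
      rwa [le_div_iff₀' hLpos] at this
  have hsub : Icc a (a + ε₀) ⊆ Icc a b := Icc_subset_Icc_right hε₀b
  have hpball : ∀ t ∈ Icc a (a + ε₀), p t ∈ Metric.closedBall (p a) ρ := by
    intro t ht
    refine hδp ⟨?_, hsub ht⟩
    rw [Metric.mem_ball, Real.dist_eq, abs_of_nonneg (sub_nonneg.2 ht.1)]
    linarith [ht.2]
  have hPL : IsPicardLindelof (fun t x => F (p t, x)) (tmin := a) (tmax := a + ε₀)
      ⟨a, left_mem_Icc.2 (by linarith)⟩ y₀ ⟨ρ, hρ.le⟩ 0 ⟨L, hLpos.le⟩ K := by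
    refine ⟨?_, ?_, ?_, ?_⟩
    · intro t ht x hx x' hx'
      have := hlip (hgood (hpball t ht) hx).1.1 (hgood (hpball t ht) hx').1.1
      simpa [Prod.edist_eq] using this
    · intro x hx
      exact hF.continuousOn.comp ((hpc.mono hsub).prodMk continuousOn_const)
        fun t ht => (hgood (hpball t ht) hx).1.2
    · intro t ht x hx
      exact (hgood (hpball t ht) hx).2.le
    · simpa [hε₀.le] using! hε₀L
  obtain ⟨y, hya, hy⟩ := hPL.exists_eq_forall_mem_Icc_hasDerivWithinAt₀
  replace hya : y a = y₀ := hya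
  have haI₀ : a ∈ Icc a (a + ε₀) := left_mem_Icc.2 (by linarith)
  -- The solution just obtained comes without information on its location. Continuity at a confines
  -- it, after shrinking the interval, to the open ball on which F is known to be smooth.
  obtain ⟨η, hη, hηy⟩ := Metric.mem_nhdsWithin_iff.1
    ((hy a haI₀).continuousWithinAt.eventually (Metric.ball_mem_nhds (y a) hρ))
  have hε : 0 < min ε₀ (η / 2) := lt_min hε₀ (half_pos hη)
  have hsub' : Icc a (a + min ε₀ (η / 2)) ⊆ Icc a (a + ε₀) :=
    Icc_subset_Icc_right (by linarith [min_le_left ε₀ (η / 2)])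
  have hyball : ∀ t ∈ Icc a (a + min ε₀ (η / 2)), y t ∈ Metric.ball y₀ ρ := by
    intro t ht
    rw [← hya]
    refine hηy ⟨?_, hsub' ht⟩
    rw [Metric.mem_ball, Real.dist_eq, abs_of_nonneg (sub_nonneg.2 ht.1)]
    linarith [ht.2, min_le_right ε₀ (η / 2)]
  have hder : ∀ t ∈ Icc a (a + min ε₀ (η / 2)),
      HasDerivWithinAt y (F (p t, y t)) (Icc a (a + min ε₀ (η / 2))) t :=
    fun t ht => (hy t (hsub' ht)).mono hsub'
  have hmemΩ : ∀ t ∈ Icc a (a + min ε₀ (η / 2)), ∀ x ∈ Metric.ball y₀ ρ, (p t, x) ∈ Ω :=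
    fun t ht x hx => (hgood (hpball t (hsub' ht)) (Metric.ball_subset_closedBall hx)).1.2
  refine ⟨min ε₀ (η / 2), hε, by linarith [min_le_left ε₀ (η / 2)], y, hya, ?_,
    fun t ht => ⟨hmemΩ t ht _ (hyball t ht), hder t ht⟩⟩
  -- Bootstrapping: a solution of an equation with smooth right-hand side is smooth.
  refine ODE.contDiffOn_enat_Icc_of_hasDerivWithinAt (f := fun t x => F (p t, x))
    (u := Metric.ball y₀ ρ) (n := ⊤) ?_ hder hyball
  refine hF.comp (((hp.mono (hsub'.trans hsub)).comp contDiff_fst.contDiffOn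
    fun z hz => hz.1).prodMk contDiff_snd.contDiffOn) ?_
  rintro ⟨t, x⟩ ⟨ht, hx⟩
  exact hmemΩ t ht x hx

end ODEParam
/-! ### Locality of anisotropic connections -/

section Connection

variable {E : Type*} [NormedAddCommGroup E] [NormedSpace ℝ E]
  {M : Type*} [TopologicalSpace M] [ChartedSpace E M]

/-- The directional derivative of a function along the velocity of a curve. -/
lemma hasDerivWithinAt_comp_curve (f : C^∞⟮𝓘(ℝ, E), M; ℝ⟯) {γ : ℝ → M} {a b t : ℝ}
    (hγ : MDifferentiableWithinAt 𝓘(ℝ) 𝓘(ℝ, E) γ (Icc a b) t) :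
    HasDerivWithinAt (fun τ => f (γ τ))
      (dirDeriv f (AnisotropicConnection.velocity E γ a b t)) (Icc a b) t := by
  have hf : HasMFDerivAt 𝓘(ℝ, E) 𝓘(ℝ) f (γ t) (mfderiv 𝓘(ℝ, E) 𝓘(ℝ) f (γ t)) :=
    (f.contMDiff.mdifferentiable (by simp) (γ t)).hasMFDerivAt
  have h := hf.comp_hasMFDerivWithinAt t hγ.hasMFDerivWithinAt
  have h' : HasFDerivWithinAt (𝕜 := ℝ) (E := ℝ) (F := ℝ) (fun τ => f (γ τ)) _ (Icc a b) t :=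
    h.hasFDerivWithinAt
  exact h'.hasDerivWithinAt

variable [IsManifold 𝓘(ℝ, E) ∞ M]

variable (E) in
/-- The trivialization of `TM` given by the natural coordinates around `p`. -/
abbrev tangentTriv (p : M) : Trivialization E (π E (TangentSpace 𝓘(ℝ, E) : M → Type _)) :=
  trivializationAt E (TangentSpace 𝓘(ℝ, E)) p

lemma mem_baseSet_tangentTriv (p : M) : p ∈ (tangentTriv E p).baseSet :=
  mem_chart_source E p

lemma tangentTriv_apply_snd {p q : M} (hq : q ∈ (chartAt E p).source)
    (w : TangentSpace 𝓘(ℝ, E) q) :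
    (tangentTriv E p ⟨q, w⟩).2 = (tangentTriv E p).continuousLinearMapAt ℝ q w := by
  rw [Trivialization.continuousLinearMapAt_apply, Trivialization.coe_linearMapAt_of_mem]
  exact hq

lemma VField.mulFun_apply (f : C^∞⟮𝓘(ℝ, E), M; ℝ⟯) (X : VField E M) (q : M) :
    VField.mulFun f X q = f q • X q := rfl

lemma VField.sum_apply {ι : Type*} (S : Finset ι) (X : ι → VField E M) (q : M) :
    (∑ i ∈ S, X i) q = ∑ i ∈ S, X i q := by
  classical
  induction S using Finset.induction_on with
  | empty => rfl
  | insert i S hi ih => rw [Finset.sum_insert hi, Finset.sum_insert hi, ← ih]; rfl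

variable [FiniteDimensional ℝ E] [T2Space M]

variable (E) in
/-- The bump function used in `coordExt`. -/
def coordBump (p : M) : SmoothBumpFunction 𝓘(ℝ, E) p := Classical.arbitrary _

/-- The field which near `p` has the constant coordinates `w` in the natural coordinates
around `p`. -/
def coordFrame (p : M) (w : E) : VField E M :=
  coordExt (p := p) ((tangentTriv E p).symmL ℝ p w)

lemma coordFrame_apply (p : M) (w : E) (q : M) :
    coordFrame p w q = coordBump E p q • (tangentTriv E p).symmL ℝ q w := by
  change coordBump E p q • constField _ q = _
  rw [constField, Trivialization.continuousLinearMapAt_symmL _ (mem_baseSet_tangentTriv p)]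

lemma coordExt_eq_coordFrame {p : M} (w : TangentSpace 𝓘(ℝ, E) p) :
    coordExt w = coordFrame p ((tangentTriv E p).continuousLinearMapAt ℝ p w) := by
  rw [coordFrame, Trivialization.symmL_continuousLinearMapAt _ (mem_baseSet_tangentTriv p)]

lemma coordFrame_self (p : M) (w : E) :
    coordFrame p w p = (tangentTriv E p).symmL ℝ p w := by
  rw [coordFrame_apply, SmoothBumpFunction.eq_one, one_smul]

lemma coordExt_self {p : M} (w : TangentSpace 𝓘(ℝ, E) p) : coordExt w p = w := by
  rw [coordExt_eq_coordFrame, coordFrame_self,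
    Trivialization.symmL_continuousLinearMapAt _ (mem_baseSet_tangentTriv p)]

/-- The components of a vector field in the natural coordinates around `p`, cut off. -/
def coordComp (p : M) (Z : VField E M) (k : Fin (Module.finrank ℝ E)) : C^∞⟮𝓘(ℝ, E), M; ℝ⟯ :=
  ⟨fun q => coordBump E p q • (Module.finBasis ℝ E).coord k (tangentTriv E p ⟨q, Z q⟩).2, by
    refine (coordBump E p).contMDiff_smul ?_
    have hZ : ContMDiffOn 𝓘(ℝ, E) 𝓘(ℝ, E) ∞ (fun q => (tangentTriv E p ⟨q, Z q⟩).2)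
        (chartAt E p).source := by
      intro q hq
      exact ((tangentTriv E p).contMDiffWithinAt_section _ hq).1 (Z.contMDiff q).contMDiffWithinAt
    exact ((LinearMap.toContinuousLinearMap
      ((Module.finBasis ℝ E).coord k)).contMDiff.comp_contMDiffOn hZ)⟩

/-- The square of the bump function used in `coordExt`. -/
def coordCut (p : M) : C^∞⟮𝓘(ℝ, E), M; ℝ⟯ :=
  ⟨fun q => coordBump E p q • coordBump E p q,
    (coordBump E p).contMDiff.smul (coordBump E p).contMDiff⟩

lemma coordCut_self (p : M) : coordCut (E := E) p p = 1 := by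
  change coordBump E p p • coordBump E p p = 1
  rw [SmoothBumpFunction.eq_one, one_smul]

/-- The cutoff is constant near p, so multiplying a field by it creates no Leibniz term at p. -/
lemma dirDeriv_coordCut (p : M) (u : TangentSpace 𝓘(ℝ, E) p) : dirDeriv (coordCut p) u = 0 := by
  have h : (coordCut (E := E) p : M → ℝ) =ᶠ[𝓝 p] (ContMDiffMap.const 1 : C^∞⟮𝓘(ℝ, E), M; ℝ⟯) := by
    filter_upwards [(coordBump E p).eventuallyEq_one] with q hq
    change coordBump E p q • coordBump E p q = 1
    rw [hq]
    simp
  have h0 := dirDeriv_const (1 : ℝ) u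
  rw [dirDeriv] at h0 ⊢
  rw [h.mfderiv_eq]
  exact h0

/-- The square of the bump function χ appears because two local objects have to be made global: χ²Z
= ∑ (χZᵏ)(χ∂ₖ). Inside the chart this is the expansion in the coordinate frame; outside it both
sides vanish. It makes ∇, which acts on global fields only, computable near p. -/
lemma mulFun_coordCut (p : M) (Z : VField E M) :
    VField.mulFun (coordCut p) Z =
      ∑ k, VField.mulFun (coordComp p Z k) (coordFrame p (Module.finBasis ℝ E k)) := by
  ext q
  rw [VField.sum_apply]
  simp only [VField.mulFun_apply, coordFrame_apply]
  by_cases hq : q ∈ (chartAt E p).source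
  · have h1 : ∀ k, coordComp p Z k q = coordBump E p q *
        (Module.finBasis ℝ E).coord k ((tangentTriv E p).continuousLinearMapAt ℝ q (Z q)) := by
      intro k
      rw [← tangentTriv_apply_snd hq]
      rfl
    have h2 : coordCut p q = coordBump E p q * coordBump E p q := rfl
    have h3 : Z q = ∑ k, (Module.finBasis ℝ E).coord k
        ((tangentTriv E p).continuousLinearMapAt ℝ q (Z q)) •
          (tangentTriv E p).symmL ℝ q (Module.finBasis ℝ E k) := by
      simp_rw [← map_smul, ← map_sum, Module.Basis.coord_apply, Module.Basis.sum_repr]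
      exact (Trivialization.symmL_continuousLinearMapAt _ hq _).symm
    conv_lhs => rw [h3]
    rw [h2, Finset.smul_sum]
    refine Finset.sum_congr rfl fun k _ => ?_
    rw [h1, smul_smul, smul_smul]
    congr 1
    ring
  · have h0 : coordBump E p q = 0 := by
      by_contra h
      exact hq ((coordBump E p).support_subset_source h)
    have h2 : coordCut p q = coordBump E p q * coordBump E p q := rfl
    simp [h2, h0]

end Connection

/-! ### Pointwise dependence on the direction, and ∇ as a derivative along curves -/

namespace AnisotropicConnection

variable {E : Type*} [NormedAddCommGroup E] [NormedSpace ℝ E]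
  {M : Type*} [TopologicalSpace M] [ChartedSpace E M] [IsManifold 𝓘(ℝ, E) ∞ M]
  {A : Set (TangentBundle 𝓘(ℝ, E) M)} (nabla : AnisotropicConnection A)

lemma toFun_sum_right {v : TangentBundle 𝓘(ℝ, E) M} (hv : v ∈ A) {ι : Type*} (S : Finset ι)
    (X : VField E M) (f : ι → C^∞⟮𝓘(ℝ, E), M; ℝ⟯) (Y : ι → VField E M) :
    nabla.toFun X (∑ i ∈ S, VField.mulFun (f i) (Y i)) v =
      ∑ i ∈ S, (dirDeriv (f i) (X v.proj) • Y i v.proj + f i v.proj • nabla.toFun X (Y i) v) := by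
  classical
  induction S using Finset.induction_on with
  | empty =>
    -- From 0 + 0 = 0 and additivity, ∇_X 0 equals twice itself and so vanishes.
    have h := nabla.add_right X 0 0 v hv
    rw [add_zero] at h
    simpa using h
  | insert i S hi ih =>
    rw [Finset.sum_insert hi, Finset.sum_insert hi, nabla.add_right _ _ _ v hv, ih,
      nabla.leibniz _ _ _ v hv]

lemma toFun_sum_left {v : TangentBundle 𝓘(ℝ, E) M} (hv : v ∈ A) {ι : Type*} (S : Finset ι)
    (f : ι → C^∞⟮𝓘(ℝ, E), M; ℝ⟯) (X : ι → VField E M) (Z : VField E M) :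
    nabla.toFun (∑ i ∈ S, VField.mulFun (f i) (X i)) Z v =
      ∑ i ∈ S, f i v.proj • nabla.toFun (X i) Z v := by
  classical
  have h1 : ∀ W : VField E M, VField.mulFun (ContMDiffMap.const 1) W = W := fun W => by
    ext q
    exact one_smul ℝ (W q)
  induction S using Finset.induction_on with
  | empty =>
    have h := nabla.linear_left (ContMDiffMap.const 1) (ContMDiffMap.const 1) 0 0 Z v hv
    have hc : (ContMDiffMap.const 1 : C^∞⟮𝓘(ℝ, E), M; ℝ⟯) v.proj = 1 := rfl
    rw [h1, add_zero, hc, one_smul] at h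
    simpa using h
  | insert i S hi ih =>
    rw [Finset.sum_insert hi, Finset.sum_insert hi, ← ih]
    have h := nabla.linear_left (f i) (ContMDiffMap.const 1) (X i)
      (∑ i ∈ S, VField.mulFun (f i) (X i)) Z v hv
    have hc : (ContMDiffMap.const 1 : C^∞⟮𝓘(ℝ, E), M; ℝ⟯) v.proj = 1 := rfl
    rwa [h1, hc, one_smul] at h

lemma toFun_mulFun_left {v : TangentBundle 𝓘(ℝ, E) M} (hv : v ∈ A)
    (f : C^∞⟮𝓘(ℝ, E), M; ℝ⟯) (X Z : VField E M) :
    nabla.toFun (VField.mulFun f X) Z v = f v.proj • nabla.toFun X Z v := by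
  simpa using nabla.toFun_sum_left hv {()} (fun _ => f) (fun _ => X) Z

variable [FiniteDimensional ℝ E] [T2Space M]

/-- `(∇_X Z)_v` depends on `X` only through its value at `π(v)`. -/
lemma toFun_congr_left {v : TangentBundle 𝓘(ℝ, E) M} (hv : v ∈ A) {X X' : VField E M}
    (Z : VField E M) (h : X v.proj = X' v.proj) : nabla.toFun X Z v = nabla.toFun X' Z v := by
  -- Function-linearity applied to the cut-off expansion of X leaves only the components of X at the
  -- base point.
  have key : ∀ X : VField E M, nabla.toFun X Z v =
      ∑ k, coordComp v.proj X k v.proj •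
        nabla.toFun (coordFrame v.proj (Module.finBasis ℝ E k)) Z v := by
    intro X
    rw [← nabla.toFun_sum_left hv, ← mulFun_coordCut, nabla.toFun_mulFun_left hv, coordCut_self,
      one_smul]
  have hc : ∀ k, coordComp v.proj X k v.proj = coordComp v.proj X' k v.proj := by
    intro k
    change coordBump E v.proj v.proj • (Module.finBasis ℝ E).coord k
        (tangentTriv E v.proj ⟨v.proj, X v.proj⟩).2 = coordBump E v.proj v.proj •
        (Module.finBasis ℝ E).coord k (tangentTriv E v.proj ⟨v.proj, X' v.proj⟩).2
    rw [h]
  rw [key X, key X']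
  simp_rw [hc]

/-- The connection in the natural coordinates around the base point, in terms of covariant
derivatives along curves. -/
lemma toFun_eq_covDerivAlong {γ : ℝ → M} {a b t : ℝ} (hab : a < b) (ht : t ∈ Icc a b)
    (hγ : MDifferentiableWithinAt 𝓘(ℝ) 𝓘(ℝ, E) γ (Icc a b) t) {v : TangentSpace 𝓘(ℝ, E) (γ t)}
    (hv : (⟨γ t, v⟩ : TangentBundle 𝓘(ℝ, E) M) ∈ A) (X Z : VField E M)
    (hX : X (γ t) = velocity E γ a b t) :
    nabla.toFun X Z ⟨γ t, v⟩ = nabla.covDerivAlong γ a b (fun τ => Z (γ τ)) t v := by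
  -- The cutoff has value 1 and derivative 0 at γ(t). The Leibniz rule on the expansion of the
  -- cut-off field then splits into derivatives of components, which become derivatives along γ
  -- because X(γ(t)) is the velocity, and Christoffel terms.
  have h1 : nabla.toFun X Z ⟨(γ t), v⟩ = nabla.toFun X (VField.mulFun (coordCut (γ t)) Z) ⟨(γ t), v⟩ := by
    rw [nabla.leibniz _ _ _ _ hv, dirDeriv_coordCut, coordCut_self, zero_smul, zero_add, one_smul]
  rw [h1, mulFun_coordCut, nabla.toFun_sum_right hv, Finset.sum_add_distrib, covDerivAlong]
  have hbump : ∀ᶠ τ in 𝓝[Icc a b] t, coordBump E (γ t) (γ τ) = 1 :=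
    hγ.continuousWithinAt.eventually (coordBump E (γ t)).eventuallyEq_one
  have hd : HasDerivWithinAt (fun τ => (tangentTriv E (γ t) ⟨γ τ, Z (γ τ)⟩).2)
      (∑ k, dirDeriv (coordComp (γ t) Z k) (X (γ t)) • Module.finBasis ℝ E k) (Icc a b) t := by
    have hk : ∀ k, HasDerivWithinAt (fun τ => coordComp (γ t) Z k (γ τ) • Module.finBasis ℝ E k)
        (dirDeriv (coordComp (γ t) Z k) (X (γ t)) • Module.finBasis ℝ E k) (Icc a b) t := by
      intro k
      rw [hX]
      exact (hasDerivWithinAt_comp_curve _ hγ).smul_const _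
    have hev : (fun τ => (tangentTriv E (γ t) ⟨γ τ, Z (γ τ)⟩).2) =ᶠ[𝓝[Icc a b] t]
        fun τ => ∑ k, coordComp (γ t) Z k (γ τ) • Module.finBasis ℝ E k := by
      filter_upwards [hbump] with τ hτ
      have : ∀ k, coordComp (γ t) Z k (γ τ) =
          (Module.finBasis ℝ E).repr (tangentTriv E (γ t) ⟨γ τ, Z (γ τ)⟩).2 k := by
        intro k
        change coordBump E (γ t) (γ τ) • (Module.finBasis ℝ E).coord k _ = _
        rw [hτ, one_smul]
        rfl
      simp_rw [this, Module.Basis.sum_repr]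
    exact (HasDerivWithinAt.fun_sum fun k _ => hk k).congr_of_eventuallyEq hev
      (hev.eq_of_nhdsWithin ht)
  rw [hd.derivWithin (uniqueDiffOn_Icc hab t ht)]
  congr 1
  · rw [map_sum]
    refine Finset.sum_congr rfl fun k _ => ?_
    rw [map_smul]
    change _ • coordFrame (γ t) _ (γ t) = _
    rw [coordFrame_self]
  · have hlin : ∀ w, nabla.christoffel v (velocity E γ a b t) w =
        nabla.christoffelMap v hv (velocity E γ a b t) w := fun _ => rfl
    have hZ : Z (γ t) = ∑ k, coordComp (γ t) Z k (γ t) • coordFrame (γ t) (Module.finBasis ℝ E k) (γ t) := by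
      have h := congrArg (fun W : VField E M => W (γ t)) (mulFun_coordCut (γ t) Z)
      simp only [VField.sum_apply, VField.mulFun_apply, coordCut_self, one_smul] at h
      exact h
    rw [hlin, hZ, map_sum]
    refine Finset.sum_congr rfl fun k _ => ?_
    rw [map_smul]
    congr 1
    rw [coordFrame_self]
    change _ = nabla.toFun (coordExt (velocity E γ a b t)) (coordFrame (γ t) _) ⟨(γ t), v⟩
    -- The Christoffel symbols are defined with the constant extension of the velocity; it agrees
    -- with X at γ(t), which is all that matters.
    refine nabla.toFun_congr_left hv _ ?_
    change X (γ t) = coordExt (velocity E γ a b t) (γ t)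
    rw [coordExt_self, hX]

end AnisotropicConnection
/-! ### Natural coordinates on the tangent bundle -/

section Coordinates

variable {E : Type*} [NormedAddCommGroup E] [NormedSpace ℝ E]
  {M : Type*} [TopologicalSpace M] [ChartedSpace E M]

section

variable [FiniteDimensional ℝ E]

variable (E) in
/-- A neighbourhood of `p` where the fields `coordFrame p w` have constant coordinates. -/
def coordNhd (p : M) : Set M :=
  (chartAt E p).source ∩ {q | ∀ᶠ q' in 𝓝 q, coordBump E p q' = 1}

lemma isOpen_coordNhd (p : M) : IsOpen (coordNhd E p) :=
  (chartAt E p).open_source.inter isOpen_setOfPred_eventually_nhds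

lemma mem_coordNhd_self (p : M) : p ∈ coordNhd E p :=
  ⟨mem_chart_source E p, (coordBump E p).eventuallyEq_one⟩

end

variable [IsManifold 𝓘(ℝ, E) ∞ M]

/-- The tangent vector with natural coordinates `z = (x, y)` around `p`. -/
def coordPt (p : M) (z : E × E) : TangentBundle 𝓘(ℝ, E) M :=
  ⟨(extChartAt 𝓘(ℝ, E) p).symm z.1,
    (tangentTriv E p).symmL ℝ ((extChartAt 𝓘(ℝ, E) p).symm z.1) z.2⟩

/-- The natural coordinates around `p` of a tangent vector. -/
def coordOf (p : M) (v : TangentBundle 𝓘(ℝ, E) M) : E × E :=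
  (extChartAt 𝓘(ℝ, E) p v.proj, (tangentTriv E p).continuousLinearMapAt ℝ v.proj v.2)

lemma coordPt_proj_mem {p : M} {z : E × E} (hz : z.1 ∈ (extChartAt 𝓘(ℝ, E) p).target) :
    (coordPt p z).proj ∈ (chartAt E p).source := by
  rw [← extChartAt_source 𝓘(ℝ, E)]
  exact (extChartAt 𝓘(ℝ, E) p).map_target hz

lemma coordPt_coordOf {p : M} {v : TangentBundle 𝓘(ℝ, E) M}
    (hv : v.proj ∈ (chartAt E p).source) : coordPt p (coordOf p v) = v := by
  obtain ⟨q, v⟩ := v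
  have h1 : (extChartAt 𝓘(ℝ, E) p).symm (extChartAt 𝓘(ℝ, E) p q) = q :=
    (extChartAt 𝓘(ℝ, E) p).left_inv (by rwa [extChartAt_source])
  have h2 : ∀ q', q' = q → (⟨q', (tangentTriv E p).symmL ℝ q'
      ((tangentTriv E p).continuousLinearMapAt ℝ q v)⟩ : TangentBundle 𝓘(ℝ, E) M) = ⟨q, v⟩ := by
    rintro _ rfl
    rw [Trivialization.symmL_continuousLinearMapAt _ hv]
  exact h2 _ h1

lemma contMDiffOn_coordPt (p : M) : ContMDiffOn 𝓘(ℝ, E × E) 𝓘(ℝ, E).tangent ∞ (coordPt p)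
    ((extChartAt 𝓘(ℝ, E) p).target ×ˢ univ) := by
  refine ((tangentTriv E p).contMDiffOn_iff
    (fun z hz => (Trivialization.mem_source _).2 (coordPt_proj_mem hz.1))).2 ⟨?_, ?_⟩
  · exact (contMDiffOn_extChartAt_symm p).comp contDiff_fst.contMDiff.contMDiffOn fun z hz => hz.1
  · refine (contDiff_snd.contMDiff.contMDiffOn (f := (Prod.snd : E × E → E))).congr ?_
    rintro z hz
    have hz' : (coordPt p z).proj ∈ (chartAt E p).source := coordPt_proj_mem hz.1
    exact (tangentTriv_apply_snd hz' _).trans (Trivialization.continuousLinearMapAt_symmL _ hz' _)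

/-- The coordinates of the elements of `A` over the chart around `p`. -/
def coordDom (A : Set (TangentBundle 𝓘(ℝ, E) M)) (p : M) : Set (E × E) :=
  ((extChartAt 𝓘(ℝ, E) p).target ×ˢ univ) ∩ coordPt p ⁻¹' A

lemma isOpen_coordDom {A : Set (TangentBundle 𝓘(ℝ, E) M)} (hA : IsOpen A) (p : M) :
    IsOpen (coordDom A p) :=
  (contMDiffOn_coordPt p).continuousOn.isOpen_inter_preimage
    ((isOpen_extChartAt_target p).prod isOpen_univ) hA

lemma coordOf_mem_coordDom {A : Set (TangentBundle 𝓘(ℝ, E) M)} {p : M}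
    {v : TangentBundle 𝓘(ℝ, E) M} (hv : v ∈ A) (hp : v.proj ∈ (chartAt E p).source) :
    coordOf p v ∈ coordDom A p := by
  refine ⟨⟨?_, mem_univ _⟩, ?_⟩
  · exact (extChartAt 𝓘(ℝ, E) p).map_source (by rwa [extChartAt_source])
  · rwa [mem_preimage, coordPt_coordOf hp]

/-- A field along a smooth curve is smooth iff its coordinates are. -/
lemma contMDiffWithinAt_curve_iff {γ : ℝ → M} {X : ∀ t, TangentSpace 𝓘(ℝ, E) (γ t)}
    {S : Set ℝ} {t : ℝ} {p : M} (hγ : ContMDiffWithinAt 𝓘(ℝ) 𝓘(ℝ, E) ∞ γ S t)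
    (hp : γ t ∈ (chartAt E p).source) :
    ContMDiffWithinAt 𝓘(ℝ) 𝓘(ℝ, E).tangent ∞
      (fun τ => (⟨γ τ, X τ⟩ : TangentBundle 𝓘(ℝ, E) M)) S t ↔
    ContDiffWithinAt ℝ ∞ (fun τ => (tangentTriv E p ⟨γ τ, X τ⟩).2) S t := by
  have h := (tangentTriv E p).contMDiffWithinAt_iff (IB := 𝓘(ℝ, E)) (IM := 𝓘(ℝ)) (n := ∞)
    (f := fun τ => (⟨γ τ, X τ⟩ : TangentBundle 𝓘(ℝ, E) M)) (s := S) (x₀ := t)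
    ((Trivialization.mem_source _).2 hp)
  rw [← contMDiffWithinAt_iff_contDiffWithinAt]
  exact h.trans (and_iff_right hγ)

/-- The velocity of a curve in the natural coordinates around `p`. -/
lemma hasDerivWithinAt_chart_curve {γ : ℝ → M} {a b t : ℝ} {p : M}
    (hγ : MDifferentiableWithinAt 𝓘(ℝ) 𝓘(ℝ, E) γ (Icc a b) t)
    (hp : γ t ∈ (chartAt E p).source) :
    HasDerivWithinAt (fun τ => extChartAt 𝓘(ℝ, E) p (γ τ))
      ((tangentTriv E p).continuousLinearMapAt ℝ (γ t)
        (AnisotropicConnection.velocity E γ a b t)) (Icc a b) t := by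
  have h1 : HasMFDerivAt 𝓘(ℝ, E) 𝓘(ℝ, E) (extChartAt 𝓘(ℝ, E) p) (γ t) _ :=
    (mdifferentiableAt_extChartAt hp).hasMFDerivAt
  have h := h1.comp_hasMFDerivWithinAt t hγ.hasMFDerivWithinAt
  have h' : HasFDerivWithinAt (𝕜 := ℝ) (E := ℝ) (F := E)
      (fun τ => extChartAt 𝓘(ℝ, E) p (γ τ)) _ (Icc a b) t := h.hasFDerivWithinAt
  rw [TangentBundle.continuousLinearMapAt_trivializationAt hp]
  exact h'.hasDerivWithinAt

variable [FiniteDimensional ℝ E] [T2Space M]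

lemma coordFrame_of_mem {p q : M} (hq : q ∈ coordNhd E p) (w : E) :
    coordFrame p w q = (tangentTriv E p).symmL ℝ q w := by
  rw [coordFrame_apply, hq.2.self_of_nhds, one_smul]

/-- The coefficients are constant functions, so expanding the connection on this sum produces no
derivative terms. -/
lemma coordFrame_eq_sum (p : M) (w : E) : coordFrame p w =
    ∑ k, VField.mulFun (ContMDiffMap.const ((Module.finBasis ℝ E).repr w k))
      (coordFrame p (Module.finBasis ℝ E k)) := by
  ext q
  rw [VField.sum_apply]
  have : ∀ k, (VField.mulFun (ContMDiffMap.const ((Module.finBasis ℝ E).repr w k))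
      (coordFrame p (Module.finBasis ℝ E k))) q = (Module.finBasis ℝ E).repr w k •
      coordFrame p (Module.finBasis ℝ E k) q := fun k => rfl
  simp_rw [this, coordFrame_apply, smul_comm _ (coordBump E p q)]
  rw [← Finset.smul_sum]
  congr 1
  simp_rw [← map_smul]
  rw [← map_sum, Module.Basis.sum_repr]

end Coordinates

/-! ### Christoffel symbols and covariant derivatives in a fixed chart -/

namespace AnisotropicConnection

variable {E : Type*} [NormedAddCommGroup E] [NormedSpace ℝ E]
  {M : Type*} [TopologicalSpace M] [ChartedSpace E M] [IsManifold 𝓘(ℝ, E) ∞ M]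
  [FiniteDimensional ℝ E] [T2Space M]
  {A : Set (TangentBundle 𝓘(ℝ, E) M)} (nabla : AnisotropicConnection A)

/-- The components of `∇_{∂ᵢ} ∂ⱼ` in the natural coordinates around `p`. -/
def christoffelComp (p : M) (i j : Fin (Module.finrank ℝ E)) (z : E × E) : E :=
  (tangentTriv E p (⟨(coordPt p z).proj, nabla.toFun (coordFrame p (Module.finBasis ℝ E i))
    (coordFrame p (Module.finBasis ℝ E j)) (coordPt p z)⟩ : TangentBundle 𝓘(ℝ, E) M)).2

/-- The Christoffel symbols in the natural coordinates around `p`, as a bilinear map. -/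
def christoffelCoord (p : M) (z : E × E) : E →L[ℝ] E →L[ℝ] E :=
  ∑ i, ∑ j, (LinearMap.toContinuousLinearMap ((Module.finBasis ℝ E).coord i)).smulRight
    ((LinearMap.toContinuousLinearMap ((Module.finBasis ℝ E).coord j)).smulRight
      (nabla.christoffelComp p i j z))

lemma contDiffOn_christoffelComp (p : M) (i j : Fin (Module.finrank ℝ E)) :
    ContDiffOn ℝ ∞ (nabla.christoffelComp p i j) (coordDom A p) := by
  have h1 := (nabla.smooth (coordFrame p (Module.finBasis ℝ E i))
    (coordFrame p (Module.finBasis ℝ E j))).comp ((contMDiffOn_coordPt p).mono inter_subset_left)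
    (inter_subset_right : coordDom A p ⊆ _)
  refine contMDiffOn_iff_contDiffOn.1 (((tangentTriv E p).contMDiffOn_iff ?_).1 h1).2
  exact fun z hz => (Trivialization.mem_source _).2 (coordPt_proj_mem hz.1.1)

set_option synthInstance.maxHeartbeats 200000 in
lemma contDiffOn_christoffelCoord (p : M) :
    ContDiffOn ℝ ∞ (nabla.christoffelCoord p) (coordDom A p) := by
  refine ContDiffOn.sum fun i _ => ContDiffOn.sum fun j _ => ?_
  exact contDiffOn_const.smulRight
    (contDiffOn_const.smulRight (nabla.contDiffOn_christoffelComp p i j))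

/-- `christoffelCoord` is assembled from basis fields so that its smoothness is visible; bilinearity
recovers arbitrary constant arguments. Where the bump function is not locally 1 the frame is cut
off, so these are true Christoffel symbols of the chart only over `coordNhd E p`, though the
identity holds over the whole chart. -/
lemma christoffelCoord_apply {p : M} {v : TangentBundle 𝓘(ℝ, E) M} (hv : v ∈ A)
    (hp : v.proj ∈ (chartAt E p).source) (u w : E) :
    nabla.christoffelCoord p (coordOf p v) u w = (tangentTriv E p).continuousLinearMapAt ℝ v.proj
      (nabla.toFun (coordFrame p u) (coordFrame p w) v) := by
  have hcomp : ∀ i j, nabla.christoffelComp p i j (coordOf p v) =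
      (tangentTriv E p).continuousLinearMapAt ℝ v.proj
        (nabla.toFun (coordFrame p (Module.finBasis ℝ E i))
          (coordFrame p (Module.finBasis ℝ E j)) v) := by
    intro i j
    rw [christoffelComp, coordPt_coordOf hp, tangentTriv_apply_snd hp]
  rw [coordFrame_eq_sum p u, nabla.toFun_sum_left hv, map_sum]
  simp only [christoffelCoord, sum_apply, hcomp]
  refine Finset.sum_congr rfl fun i _ => ?_
  rw [coordFrame_eq_sum p w, nabla.toFun_sum_right hv, map_smul, map_sum, Finset.smul_sum]
  refine Finset.sum_congr rfl fun j _ => ?_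
  rw [dirDeriv_const, zero_smul, zero_add, map_smul]
  rfl

/-- The Leibniz rule for the covariant derivative along a curve. -/
lemma covDerivAlong_eq_sum {γ : ℝ → M} {a b t : ℝ} (hab : a < b) (ht : t ∈ Icc a b)
    (hγ : ContinuousWithinAt γ (Icc a b) t) {v : TangentSpace 𝓘(ℝ, E) (γ t)}
    (hv : (⟨γ t, v⟩ : TangentBundle 𝓘(ℝ, E) M) ∈ A) {ι : Type*} [Fintype ι]
    {X : ∀ τ, TangentSpace 𝓘(ℝ, E) (γ τ)} {Z : ι → ∀ τ, TangentSpace 𝓘(ℝ, E) (γ τ)}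
    {f : ι → ℝ → ℝ} {f' : ι → ℝ}
    (hX : ∀ᶠ τ in 𝓝[Icc a b] t, X τ = ∑ k, f k τ • Z k τ)
    (hf : ∀ k, HasDerivWithinAt (f k) (f' k) (Icc a b) t)
    (hZ : ∀ k, DifferentiableWithinAt ℝ
      (fun τ => (tangentTriv E (γ t) ⟨γ τ, Z k τ⟩).2) (Icc a b) t) :
    nabla.covDerivAlong γ a b X t v =
      ∑ k, (f' k • Z k t + f k t • nabla.covDerivAlong γ a b (Z k) t v) := by
  have hXt : X t = ∑ k, f k t • Z k t := hX.self_of_nhdsWithin ht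
  have hsrc : ∀ᶠ τ in 𝓝[Icc a b] t, γ τ ∈ (chartAt E (γ t)).source :=
    hγ.eventually ((chartAt E (γ t)).open_source.mem_nhds (mem_chart_source E (γ t)))
  have hev : (fun τ => (tangentTriv E (γ t) ⟨γ τ, X τ⟩).2) =ᶠ[𝓝[Icc a b] t]
      fun τ => ∑ k, f k τ • (tangentTriv E (γ t) ⟨γ τ, Z k τ⟩).2 := by
    filter_upwards [hX, hsrc] with τ h1 h2
    simp_rw [tangentTriv_apply_snd h2, h1, map_sum, map_smul]
  have hd := ((HasDerivWithinAt.fun_sum (u := Finset.univ)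
    fun k _ => (hf k).fun_smul (hZ k).hasDerivWithinAt).congr_of_eventuallyEq hev
    (hev.eq_of_nhdsWithin ht)).derivWithin (uniqueDiffOn_Icc hab t ht)
  have hlin : ∀ w, nabla.christoffel v (velocity E γ a b t) w =
        nabla.christoffelMap v hv (velocity E γ a b t) w := fun _ => rfl
  simp only [covDerivAlong, hlin]
  rw [hd, hXt, map_sum, map_sum, ← Finset.sum_add_distrib]
  refine Finset.sum_congr rfl fun k _ => ?_
  rw [map_add, map_smul, map_smul, map_smul, tangentTriv_apply_snd (mem_chart_source E (γ t)),
    Trivialization.symmL_continuousLinearMapAt _ (mem_baseSet_tangentTriv _), smul_add]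
  abel

/-- The covariant derivative along a curve in the natural coordinates around a point `p`. -/
lemma covDerivAlong_eq_coord {γ : ℝ → M} {a b t : ℝ} (hab : a < b) (ht : t ∈ Icc a b)
    (hγ : ContMDiffWithinAt 𝓘(ℝ) 𝓘(ℝ, E) ∞ γ (Icc a b) t) {v : TangentSpace 𝓘(ℝ, E) (γ t)}
    (hv : (⟨γ t, v⟩ : TangentBundle 𝓘(ℝ, E) M) ∈ A) {p : M} (hp : γ t ∈ coordNhd E p)
    {X : ∀ τ, TangentSpace 𝓘(ℝ, E) (γ τ)} {Y' : E}
    (hX : HasDerivWithinAt (fun τ => (tangentTriv E p ⟨γ τ, X τ⟩).2) Y' (Icc a b) t) :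
    nabla.covDerivAlong γ a b X t v = (tangentTriv E p).symmL ℝ (γ t)
      (Y' + nabla.christoffelCoord p (coordOf p ⟨γ t, v⟩)
        ((tangentTriv E p).continuousLinearMapAt ℝ (γ t) (velocity E γ a b t))
        ((tangentTriv E p).continuousLinearMapAt ℝ (γ t) (X t))) := by
  have hγd : MDifferentiableWithinAt 𝓘(ℝ) 𝓘(ℝ, E) γ (Icc a b) t :=
    hγ.mdifferentiableWithinAt (by simp)
  have hbase : γ t ∈ (tangentTriv E p).baseSet := hp.1
  set b₀ := Module.finBasis ℝ E with hb₀
  have hnhd : ∀ᶠ τ in 𝓝[Icc a b] t, γ τ ∈ coordNhd E p :=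
    hγ.continuousWithinAt.eventually ((isOpen_coordNhd p).mem_nhds hp)
  have hXsum : ∀ᶠ τ in 𝓝[Icc a b] t, X τ =
      ∑ k, b₀.repr (tangentTriv E p ⟨γ τ, X τ⟩).2 k • coordFrame p (b₀ k) (γ τ) := by
    filter_upwards [hnhd] with τ hτ
    simp_rw [coordFrame_of_mem hτ, ← map_smul, ← map_sum, b₀.sum_repr, tangentTriv_apply_snd hτ.1]
    exact (Trivialization.symmL_continuousLinearMapAt _ hτ.1 _).symm
  have hf : ∀ k, HasDerivWithinAt (fun τ => b₀.repr (tangentTriv E p ⟨γ τ, X τ⟩).2 k)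
      (b₀.repr Y' k) (Icc a b) t := fun k =>
    (LinearMap.toContinuousLinearMap (b₀.coord k)).hasFDerivAt.comp_hasDerivWithinAt t hX
  have hZ : ∀ k, DifferentiableWithinAt ℝ
      (fun τ => (tangentTriv E (γ t) ⟨γ τ, coordFrame p (b₀ k) (γ τ)⟩).2) (Icc a b) t := fun k =>
    ((contMDiffWithinAt_curve_iff hγ (mem_chart_source E (γ t))).1
      (((coordFrame p (b₀ k)).contMDiff (γ t)).comp_contMDiffWithinAt t hγ)).differentiableWithinAt
      (by simp)
  have hu : coordFrame p ((tangentTriv E p).continuousLinearMapAt ℝ (γ t)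
      (velocity E γ a b t)) (γ t) = velocity E γ a b t := by
    rw [coordFrame_of_mem hp, Trivialization.symmL_continuousLinearMapAt _ hbase]
  -- The frame of the chart at p consists of global fields. Their derivatives along γ, taken in the
  -- chart at γ(t), are therefore values of ∇, and these no longer refer to the chart at γ(t).
  rw [nabla.covDerivAlong_eq_sum hab ht hγ.continuousWithinAt hv hXsum hf hZ]
  simp_rw [← nabla.toFun_eq_covDerivAlong hab ht hγd hv _ _ hu]
  rw [nabla.christoffelCoord_apply hv hp.1, map_add,
    Trivialization.symmL_continuousLinearMapAt _ hbase, Finset.sum_add_distrib,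
    tangentTriv_apply_snd hp.1, coordFrame_eq_sum p ((tangentTriv E p).continuousLinearMapAt ℝ
      (γ t) (X t)), nabla.toFun_sum_right hv]
  simp_rw [coordFrame_of_mem hp, dirDeriv_const, zero_smul, zero_add, ← map_smul]
  rw [← map_sum, b₀.sum_repr]
  rfl

end AnisotropicConnection
/-! ### Parallel transport for short times -/

namespace AnisotropicConnection

variable {E : Type*} [NormedAddCommGroup E] [NormedSpace ℝ E]
  {M : Type*} [TopologicalSpace M] [ChartedSpace E M] [IsManifold 𝓘(ℝ, E) ∞ M]

/-- The velocity of a curve in the natural coordinates around `p`. -/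
def coordVel (p : M) (γ : ℝ → M) (a b t : ℝ) : E :=
  (tangentTriv E p).continuousLinearMapAt ℝ (γ t) (velocity E γ a b t)

/-- The position and velocity of a curve in a chart are smooth. -/
lemma contDiffOn_chart_curve {p : M} {γ : ℝ → M} {a b β : ℝ} (hβ : a < β) (hβb : β ≤ b)
    (hγ : ContMDiffOn 𝓘(ℝ) 𝓘(ℝ, E) ∞ γ (Icc a b))
    (hmem : ∀ t ∈ Icc a β, γ t ∈ (chartAt E p).source) :
    ContDiffOn ℝ ∞ (fun t => (extChartAt 𝓘(ℝ, E) p (γ t), coordVel (E := E) p γ a b t))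
      (Icc a β) := by
  have hsub : Icc a β ⊆ Icc a b := Icc_subset_Icc_right hβb
  have hc : ContDiffOn ℝ ∞ (fun t => extChartAt 𝓘(ℝ, E) p (γ t)) (Icc a β) :=
    contMDiffOn_iff_contDiffOn.1 ((contMDiffOn_extChartAt (I := 𝓘(ℝ, E)) (x := p)).comp
      (hγ.mono hsub) hmem)
  have hu : UniqueDiffOn ℝ (Icc a β) := uniqueDiffOn_Icc hβ
  refine hc.prodMk ((hc.derivWithin hu (m := ∞) (by simp)).congr fun t ht => ?_)
  have hd := hasDerivWithinAt_chart_curve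
    ((hγ t (hsub ht)).mdifferentiableWithinAt (by simp)) (hmem t ht)
  exact ((hd.mono hsub).derivWithin (hu t ht)).symm

variable [FiniteDimensional ℝ E] [T2Space M]
  {A : Set (TangentBundle 𝓘(ℝ, E) M)} (nabla : AnisotropicConnection A)

/-- On `[a, a + ε]`, the curve `Φ` of endomorphisms represents, in the natural coordinates around
`γ(a)`, the parallel transport along `γ` with respect to the observer with coordinates `y` at
`γ(a)`. -/
structure IsParallelFrame (γ : ℝ → M) (a b ε : ℝ) (y : E) (Φ : ℝ → E →L[ℝ] E) : Prop where
  pos : 0 < ε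
  le : a + ε ≤ b
  initial : Φ a = 1
  smooth : ContDiffOn ℝ ∞ Φ (Icc a (a + ε))
  mem_nhd : ∀ t ∈ Icc a (a + ε), γ t ∈ coordNhd E (γ a)
  mem_dom : ∀ t ∈ Icc a (a + ε),
    (extChartAt 𝓘(ℝ, E) (γ a) (γ t), Φ t y) ∈ coordDom A (γ a)
  isUnit : ∀ t ∈ Icc a (a + ε), IsUnit (Φ t)
  deriv : ∀ t ∈ Icc a (a + ε), HasDerivWithinAt Φ
    (-(nabla.christoffelCoord (γ a) (extChartAt 𝓘(ℝ, E) (γ a) (γ t), Φ t y)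
      (coordVel (γ a) γ a b t) ∘L Φ t)) (Icc a (a + ε)) t

/-- The equation is posed directly for the endomorphism Φ, with coefficients evaluated at Φy, so the
observer and all fields parallel to it come from one solution. The parameter curve is the position
and velocity of γ in the chart. -/
lemma exists_isParallelFrame (hA : IsOpen A) {γ : ℝ → M} {a b : ℝ} (hab : a < b)
    (hγ : ContMDiffOn 𝓘(ℝ) 𝓘(ℝ, E) ∞ γ (Icc a b)) {y : E}
    (hy : (extChartAt 𝓘(ℝ, E) (γ a) (γ a), y) ∈ coordDom A (γ a)) :
    ∃ ε Φ, nabla.IsParallelFrame γ a b ε y Φ := by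
  have haI : a ∈ Icc a b := left_mem_Icc.2 hab.le
  obtain ⟨β, hβ, hβb, hβmem⟩ : ∃ β, a < β ∧ β ≤ b ∧ ∀ t ∈ Icc a β, γ t ∈ coordNhd E (γ a) := by
    obtain ⟨δ, hδ, hball⟩ := Metric.mem_nhdsWithin_iff.1
      ((hγ.continuousOn a haI).eventually ((isOpen_coordNhd (E := E) (γ a)).mem_nhds
        (mem_coordNhd_self (γ a))))
    refine ⟨min b (a + δ / 2), lt_min hab (by linarith), min_le_left _ _, fun t ht => ?_⟩
    have h1 := ht.2.trans (min_le_left _ _)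
    have h2 := ht.2.trans (min_le_right _ _)
    refine hball ⟨?_, ht.1, h1⟩
    rw [Metric.mem_ball, Real.dist_eq, abs_of_nonneg (sub_nonneg.2 ht.1)]
    linarith
  let Ω : Set ((E × E) × (E →L[ℝ] E)) := {z | (z.1.1, z.2 y) ∈ coordDom A (γ a)}
  have hπ : ContDiff ℝ ∞ (fun z : (E × E) × (E →L[ℝ] E) => (z.1.1, z.2 y)) := by fun_prop
  have hΩ : IsOpen Ω := (isOpen_coordDom hA (γ a)).preimage hπ.continuous
  have hF : ContDiffOn ℝ ∞ (fun z : (E × E) × (E →L[ℝ] E) =>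
      -(nabla.christoffelCoord (γ a) (z.1.1, z.2 y) z.1.2 ∘L z.2)) Ω := by
    have h1 : ContDiffOn ℝ ∞ (fun z : (E × E) × (E →L[ℝ] E) =>
        nabla.christoffelCoord (γ a) (z.1.1, z.2 y)) Ω :=
      (nabla.contDiffOn_christoffelCoord (γ a)).comp hπ.contDiffOn fun z hz => hz
    exact ((h1.clm_apply (contDiff_snd.comp contDiff_fst).contDiffOn).clm_comp
      contDiff_snd.contDiffOn).neg
  obtain ⟨ε₀, hε₀, hle, Φ, hΦa, hΦs, hΦ⟩ := ODE_param_exists hΩ hF hβ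
    (contDiffOn_chart_curve hβ hβb hγ fun t ht => (hβmem t ht).1) (y₀ := (1 : E →L[ℝ] E)) hy
  have : CompleteSpace E := FiniteDimensional.complete ℝ E
  have hcont : ContinuousWithinAt Φ (Icc a (a + ε₀)) a :=
    hΦs.continuousOn a (left_mem_Icc.2 (by linarith))
  -- Invertibility is an open condition and Φ(a) = 1; a further shrinking of the interval secures
  -- it.
  obtain ⟨δ, hδ, hball⟩ := Metric.mem_nhdsWithin_iff.1
    (hcont.eventually (Units.isOpen.mem_nhds (by rw [hΦa]; exact isUnit_one)))
  have hsub : Icc a (a + min ε₀ (δ / 2)) ⊆ Icc a (a + ε₀) :=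
    Icc_subset_Icc_right (by linarith [min_le_left ε₀ (δ / 2)])
  refine ⟨min ε₀ (δ / 2), Φ, lt_min hε₀ (half_pos hδ), ?_, hΦa, hΦs.mono hsub, ?_, ?_, ?_, ?_⟩
  · linarith [min_le_left ε₀ (δ / 2)]
  · exact fun t ht => hβmem t ⟨ht.1, (hsub ht).2.trans hle⟩
  · exact fun t ht => (hΦ t (hsub ht)).1
  · intro t ht
    refine hball ⟨?_, hsub ht⟩
    rw [Metric.mem_ball, Real.dist_eq, abs_of_nonneg (sub_nonneg.2 ht.1)]
    linarith [ht.2, min_le_right ε₀ (δ / 2)]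
  · exact fun t ht => ((hΦ t (hsub ht)).2).mono hsub

/-- The field along `γ` with coordinates `Y` around `γ(a)`. -/
def coordField (γ : ℝ → M) (a : ℝ) (Y : ℝ → E) (t : ℝ) : TangentSpace 𝓘(ℝ, E) (γ t) :=
  (tangentTriv E (γ a)).symmL ℝ (γ t) (Y t)

/-- A parallel field satisfies a linear differential equation in natural coordinates. -/
lemma IsParallelOn.hasDerivWithinAt {γ : ℝ → M} {a b : ℝ} {J : Set ℝ}
    {W X : ∀ t, TangentSpace 𝓘(ℝ, E) (γ t)} {nabla : AnisotropicConnection A}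
    (h : nabla.IsParallelOn γ a b J W X) (hab : a < b)
    (hγ : ContMDiffOn 𝓘(ℝ) 𝓘(ℝ, E) ∞ γ (Icc a b)) (hJ : J ⊆ Icc a b) {t : ℝ} (ht : t ∈ J)
    (hJt : J ∈ 𝓝[Icc a b] t) {p : M} (hp : γ t ∈ coordNhd E p)
    (hW : (⟨γ t, W t⟩ : TangentBundle 𝓘(ℝ, E) M) ∈ A) :
    HasDerivWithinAt (fun τ => (tangentTriv E p ⟨γ τ, X τ⟩).2)
      (-(nabla.christoffelCoord p (coordOf p ⟨γ t, W t⟩) (coordVel p γ a b t)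
        (tangentTriv E p ⟨γ t, X t⟩).2)) (Icc a b) t := by
  have hγt := hγ t (hJ ht)
  have hs : ContMDiffWithinAt 𝓘(ℝ) 𝓘(ℝ, E).tangent ∞
      (fun t => (⟨γ t, X t⟩ : TangentBundle 𝓘(ℝ, E) M)) (Icc a b) t :=
    (h.smooth t ht).mono_of_mem_nhdsWithin hJt
  have hd := (((contMDiffWithinAt_curve_iff hγt hp.1).1 hs).differentiableWithinAt
    (by simp)).hasDerivWithinAt
  have hpar := h.parallel t ht
  rw [nabla.covDerivAlong_eq_coord hab (hJ ht) hγt hW hp hd] at hpar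
  have hz := congrArg ((tangentTriv E p).continuousLinearMapAt ℝ (γ t)) hpar
  rw [Trivialization.continuousLinearMapAt_symmL _ hp.1, map_zero] at hz
  rw [coordVel, tangentTriv_apply_snd hp.1, ← eq_neg_of_add_eq_zero_left hz]
  exact hd

/-! ### Identification of the transports with the frame Φ -/

namespace IsParallelFrame

variable {nabla} {γ : ℝ → M} {a b ε : ℝ} {y : E} {Φ : ℝ → E →L[ℝ] E}

lemma snd_coordField (h : nabla.IsParallelFrame γ a b ε y Φ) (Y : ℝ → E) {t : ℝ}
    (ht : t ∈ Icc a (a + ε)) :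
    (tangentTriv E (γ a) ⟨γ t, coordField γ a Y t⟩).2 = Y t := by
  rw [tangentTriv_apply_snd (h.mem_nhd t ht).1, coordField,
    Trivialization.continuousLinearMapAt_symmL _ (h.mem_nhd t ht).1]

lemma coordOf_coordField (h : nabla.IsParallelFrame γ a b ε y Φ) (Y : ℝ → E) {t : ℝ}
    (ht : t ∈ Icc a (a + ε)) :
    coordOf (γ a) ⟨γ t, coordField γ a Y t⟩ = (extChartAt 𝓘(ℝ, E) (γ a) (γ t), Y t) := by
  rw [← h.snd_coordField Y ht, tangentTriv_apply_snd (h.mem_nhd t ht).1]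
  rfl

lemma admissible (h : nabla.IsParallelFrame γ a b ε y Φ) {t : ℝ} (ht : t ∈ Icc a (a + ε)) :
    (⟨γ t, coordField γ a (Φ · y) t⟩ : TangentBundle 𝓘(ℝ, E) M) ∈ A := by
  have := (h.mem_dom t ht).2
  rwa [← h.coordOf_coordField (Φ · y) ht, mem_preimage,
    coordPt_coordOf (h.mem_nhd t ht).1] at this

lemma Icc_subset (h : nabla.IsParallelFrame γ a b ε y Φ) : Icc a (a + ε) ⊆ Icc a b :=
  Icc_subset_Icc_right h.le

/-- Transport intervals have to be relatively open in [a, b], hence the half-open interval, although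
Φ is controlled on the closed one. -/
lemma Ico_mem_nhdsWithin {t : ℝ} (ht : t ∈ Ico a (a + ε)) :
    Ico a (a + ε) ∈ 𝓝[Icc a b] t := by
  filter_upwards [self_mem_nhdsWithin, mem_nhdsWithin_of_mem_nhds (Iio_mem_nhds ht.2)]
    with τ h1 h2 using ⟨h1.1, h2⟩

lemma isTransportInterval (h : nabla.IsParallelFrame γ a b ε y Φ) {t₁ t₂ : ℝ}
    (ht₁ : t₁ ∈ Ico a (a + ε)) (ht₂ : t₂ ∈ Ico a (a + ε)) :
    IsTransportInterval a b (Ico a (a + ε)) t₁ t₂ where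
  subset := Ico_subset_Icc_self.trans h.Icc_subset
  ordConnected := ordConnected_Ico
  mem_nhdsWithin _ ht := Ico_mem_nhdsWithin ht
  left_mem := ht₁
  right_mem := ht₂

/-- Applying the equation for Φ to a constant vector w gives the parallel transport equation in the
chart at γ(a). The case w = y is the observer itself. -/
lemma isParallelOn (h : nabla.IsParallelFrame γ a b ε y Φ) (hab : a < b)
    (hγ : ContMDiffOn 𝓘(ℝ) 𝓘(ℝ, E) ∞ γ (Icc a b)) (w : E) :
    nabla.IsParallelOn γ a b (Ico a (a + ε)) (coordField γ a (Φ · y)) (coordField γ a (Φ · w)) := by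
  have hsub : Ico a (a + ε) ⊆ Icc a (a + ε) := Ico_subset_Icc_self
  refine ⟨fun t ht => ?_, fun t ht => ?_⟩
  · have ht' := hsub ht
    refine (contMDiffWithinAt_curve_iff ((hγ t (h.Icc_subset ht')).mono
      (hsub.trans h.Icc_subset)) (h.mem_nhd t ht').1).2 ?_
    have hs : ContDiffOn ℝ ∞ (fun τ => Φ τ w) (Ico a (a + ε)) :=
      (h.smooth.mono hsub).clm_apply contDiffOn_const
    exact (hs t ht).congr (fun τ hτ => h.snd_coordField _ (hsub hτ)) (h.snd_coordField _ ht')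
  · have ht' := hsub ht
    have hd : HasDerivWithinAt (fun τ => (tangentTriv E (γ a) ⟨γ τ, coordField γ a (Φ · w) τ⟩).2)
        (-(nabla.christoffelCoord (γ a) (extChartAt 𝓘(ℝ, E) (γ a) (γ t), Φ t y)
          (coordVel (γ a) γ a b t) (Φ t w))) (Icc a b) t := by
      have h1 := ((h.deriv t ht').clm_apply (hasDerivWithinAt_const t _ w)).congr
        (fun τ hτ => h.snd_coordField (Φ · w) hτ) (h.snd_coordField (Φ · w) ht')
      refine (h1.mono_of_mem_nhdsWithin
        (Filter.mem_of_superset (Ico_mem_nhdsWithin ht) hsub)).congr_deriv ?_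
      simp
    rw [nabla.covDerivAlong_eq_coord hab (h.Icc_subset ht') (hγ t (h.Icc_subset ht'))
      (h.admissible ht') (h.mem_nhd t ht') hd, h.coordOf_coordField _ ht',
      ← tangentTriv_apply_snd (h.mem_nhd t ht').1 (coordField γ a (Φ · w) t), h.snd_coordField _ ht', coordVel,
      neg_add_cancel, map_zero]

lemma isParallelObserverOn (h : nabla.IsParallelFrame γ a b ε y Φ) (hab : a < b)
    (hγ : ContMDiffOn 𝓘(ℝ) 𝓘(ℝ, E) ∞ γ (Icc a b)) :
    nabla.IsParallelObserverOn γ a b (Ico a (a + ε)) (coordField γ a (Φ · y)) :=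
  ⟨fun _ ht => h.admissible (Ico_subset_Icc_self ht), h.isParallelOn hab hγ y⟩

lemma uIcc_subset {J : Set ℝ} {t₁ t₂ : ℝ} (hJ : IsTransportInterval a b J t₁ t₂)
    (ht₁ : t₁ ∈ Ico a (a + ε)) (ht₂ : t₂ ∈ Ico a (a + ε)) :
    uIcc t₁ t₂ ⊆ J ∩ Icc a (a + ε) :=
  subset_inter (hJ.ordConnected.uIcc_subset hJ.left_mem hJ.right_mem)
    (uIcc_subset_Icc (Ico_subset_Icc_self ht₁) (Ico_subset_Icc_self ht₂))

lemma continuousOn_chart (h : nabla.IsParallelFrame γ a b ε y Φ)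
    (hγ : ContMDiffOn 𝓘(ℝ) 𝓘(ℝ, E) ∞ γ (Icc a b)) :
    ContinuousOn (fun t => (extChartAt 𝓘(ℝ, E) (γ a) (γ t), coordVel (E := E) (γ a) γ a b t))
      (Icc a (a + ε)) :=
  (contDiffOn_chart_curve (by linarith [h.pos]) h.le hγ
    fun t ht => (h.mem_nhd t ht).1).continuousOn

/-- Parallel observers are unique. -/
lemma observer_unique (h : nabla.IsParallelFrame γ a b ε y Φ) (hA : IsOpen A) (hab : a < b)
    (hγ : ContMDiffOn 𝓘(ℝ) 𝓘(ℝ, E) ∞ γ (Icc a b)) {J : Set ℝ} {t₁ t₂ : ℝ}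
    (ht₁ : t₁ ∈ Ico a (a + ε)) (ht₂ : t₂ ∈ Ico a (a + ε))
    (hJ : IsTransportInterval a b J t₁ t₂) {V : ∀ t, TangentSpace 𝓘(ℝ, E) (γ t)}
    (hV : nabla.IsParallelObserverOn γ a b J V) (h₁ : V t₁ = coordField γ a (Φ · y) t₁) :
    ∀ t ∈ uIcc t₁ t₂, V t = coordField γ a (Φ · y) t := by
  have hsub := uIcc_subset hJ ht₁ ht₂
  have hI : uIcc t₁ t₂ ⊆ Icc a b := fun t ht => h.Icc_subset (hsub ht).2
  have key : EqOn (fun t => Φ t y) (fun t => (tangentTriv E (γ a) ⟨γ t, V t⟩).2) (uIcc t₁ t₂) := by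
    -- The observer equation is nonlinear, since V also enters through Γ_V. Uniqueness needs
    -- regularity of F only along the known solution Φy, which stays in the open set `coordDom A (γ
    -- a)`.
    refine ODE_param_unique (F := fun z : (E × E) × E =>
        -(nabla.christoffelCoord (γ a) (z.1.1, z.2) z.1.2 z.2))
      (p := fun t => (extChartAt 𝓘(ℝ, E) (γ a) (γ t), coordVel (E := E) (γ a) γ a b t))
      ((h.continuousOn_chart hγ).mono fun t ht => (hsub ht).2) ?_ ?_ ?_ left_mem_uIcc ?_
    · intro t ht
      have hdom := (isOpen_coordDom hA (γ a)).mem_nhds (h.mem_dom t (hsub ht).2)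
      have h1 : ContDiffAt ℝ ∞ (nabla.christoffelCoord (γ a))
          (extChartAt 𝓘(ℝ, E) (γ a) (γ t), Φ t y) :=
        (nabla.contDiffOn_christoffelCoord (γ a)).contDiffAt hdom
      have h2 : ContDiffAt ℝ ∞ (fun z : (E × E) × E => nabla.christoffelCoord (γ a) (z.1.1, z.2))
          ((extChartAt 𝓘(ℝ, E) (γ a) (γ t), coordVel (γ a) γ a b t), Φ t y) :=
        ContDiffAt.comp (g := nabla.christoffelCoord (γ a))
          (f := fun z : (E × E) × E => (z.1.1, z.2)) _ h1
          (by fun_prop)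
      exact ((h2.clm_apply (contDiff_snd.comp contDiff_fst).contDiffAt).clm_apply
        contDiff_snd.contDiffAt).neg.of_le (by exact_mod_cast le_top)
    · intro t ht
      refine (((h.deriv t (hsub ht).2).clm_apply (hasDerivWithinAt_const t _ y)).mono
        fun τ hτ => (hsub hτ).2).congr_deriv ?_
      simp
    · intro t ht
      have h1 := (hV.parallel.hasDerivWithinAt hab hγ hJ.subset (hsub ht).1
        (hJ.mem_nhdsWithin t (hsub ht).1) (h.mem_nhd t (hsub ht).2)
        (hV.admissible t (hsub ht).1)).mono hI
      refine h1.congr_deriv ?_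
      rw [tangentTriv_apply_snd (h.mem_nhd t (hsub ht).2).1]
      rfl
    · rw [h₁, h.snd_coordField _ (Ico_subset_Icc_self ht₁)]
  intro t ht
  have hk : Φ t y = (tangentTriv E (γ a) ⟨γ t, V t⟩).2 := key ht
  rw [coordField, hk, tangentTriv_apply_snd (h.mem_nhd t (hsub ht).2).1,
    Trivialization.symmL_continuousLinearMapAt _ (h.mem_nhd t (hsub ht).2).1]

/-- Fields which are parallel with respect to a parallel observer are unique. -/
lemma parallel_unique (h : nabla.IsParallelFrame γ a b ε y Φ) (hA : IsOpen A) (hab : a < b)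
    (hγ : ContMDiffOn 𝓘(ℝ) 𝓘(ℝ, E) ∞ γ (Icc a b)) {t₁ t₂ : ℝ}
    (ht₁ : t₁ ∈ Ico a (a + ε)) (ht₂ : t₂ ∈ Ico a (a + ε))
    {W : ∀ t, TangentSpace 𝓘(ℝ, E) (γ t)}
    (hW : nabla.IsParallelWrtObserver γ a b t₁ t₂ (coordField γ a (Φ · y) t₁) W) :
    W t₂ = (tangentTriv E (γ a)).symmL ℝ (γ t₂) (Φ t₂ (Ring.inverse (Φ t₁)
      ((tangentTriv E (γ a)).continuousLinearMapAt ℝ (γ t₁) (W t₁)))) := by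
  obtain ⟨J, V, hJ, hV₁, hV, hW⟩ := hW
  have hVeq := h.observer_unique hA hab hγ ht₁ ht₂ hJ hV hV₁
  have hsub := uIcc_subset hJ ht₁ ht₂
  have hI : uIcc t₁ t₂ ⊆ Icc a b := fun t ht => h.Icc_subset (hsub ht).2
  have ht₁' := Ico_subset_Icc_self ht₁
  have ht₂' := Ico_subset_Icc_self ht₂
  -- The value at a which Φ carries to W(t₁).
  set w := Ring.inverse (Φ t₁) ((tangentTriv E (γ a)).continuousLinearMapAt ℝ (γ t₁) (W t₁))
    with hw
  have hcont : ContinuousOn (fun t => -(nabla.christoffelCoord (γ a)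
      (extChartAt 𝓘(ℝ, E) (γ a) (γ t), Φ t y) (coordVel (γ a) γ a b t))) (Icc a (a + ε)) := by
    have h1 := h.continuousOn_chart hγ
    have h2 : ContinuousOn (fun t => (extChartAt 𝓘(ℝ, E) (γ a) (γ t), Φ t y)) (Icc a (a + ε)) :=
      (continuous_fst.comp_continuousOn h1).prodMk
        (h.smooth.continuousOn.clm_apply continuousOn_const)
    exact (((nabla.contDiffOn_christoffelCoord (γ a)).continuousOn.comp h2 h.mem_dom).clm_apply
      (continuous_snd.comp_continuousOn h1)).neg
  have key : EqOn (fun t => Φ t w) (fun t => (tangentTriv E (γ a) ⟨γ t, W t⟩).2)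
      (uIcc t₁ t₂) := by
    -- With the observer identified, the equation for W is linear; its continuous coefficient plays
    -- the role of the parameter curve.
    refine ODE_param_unique (F := fun z : (E →L[ℝ] E) × E => z.1 z.2) (p := fun t =>
      -(nabla.christoffelCoord (γ a) (extChartAt 𝓘(ℝ, E) (γ a) (γ t), Φ t y)
        (coordVel (γ a) γ a b t))) (hcont.mono fun t ht => (hsub ht).2) ?_ ?_ ?_ left_mem_uIcc ?_
    · intro t ht
      fun_prop
    · intro t ht
      refine (((h.deriv t (hsub ht).2).clm_apply (hasDerivWithinAt_const t _ w)).mono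
        fun τ hτ => (hsub hτ).2).congr_deriv ?_
      simp
    · intro t ht
      have h1 := (hW.hasDerivWithinAt hab hγ hJ.subset (hsub ht).1
        (hJ.mem_nhdsWithin t (hsub ht).1) (h.mem_nhd t (hsub ht).2)
        (hV.admissible t (hsub ht).1)).mono hI
      refine h1.congr_deriv ?_
      rw [hVeq t ht, h.coordOf_coordField _ (hsub ht).2]
      rfl
    · rw [hw, tangentTriv_apply_snd (h.mem_nhd t₁ ht₁').1]
      exact congrArg (fun L : E →L[ℝ] E => L _) (Ring.mul_inverse_cancel _ (h.isUnit t₁ ht₁'))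
  have hk : Φ t₂ w = (tangentTriv E (γ a) ⟨γ t₂, W t₂⟩).2 := key right_mem_uIcc
  rw [hk, tangentTriv_apply_snd (h.mem_nhd t₂ ht₂').1,
    Trivialization.symmL_continuousLinearMapAt _ (h.mem_nhd t₂ ht₂').1]

/-- The frame shows that the defining choice is made among existing fields, so the default value 0
is avoided; uniqueness makes the choice irrelevant. -/
lemma observerTransport_eq (h : nabla.IsParallelFrame γ a b ε y Φ) (hA : IsOpen A) (hab : a < b)
    (hγ : ContMDiffOn 𝓘(ℝ) 𝓘(ℝ, E) ∞ γ (Icc a b)) {t₁ t₂ : ℝ}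
    (ht₁ : t₁ ∈ Ico a (a + ε)) (ht₂ : t₂ ∈ Ico a (a + ε)) :
    nabla.observerTransport γ a b t₁ t₂ (coordField γ a (Φ · y) t₁) =
      coordField γ a (Φ · y) t₂ := by
  have hex : ∃ V : ∀ t, TangentSpace 𝓘(ℝ, E) (γ t), V t₁ = coordField γ a (Φ · y) t₁ ∧
      ∃ J, IsTransportInterval a b J t₁ t₂ ∧ nabla.IsParallelObserverOn γ a b J V :=
    ⟨_, rfl, _, h.isTransportInterval ht₁ ht₂, h.isParallelObserverOn hab hγ⟩
  rw [observerTransport, dif_pos hex]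
  obtain ⟨h₁, J, hJ, hV⟩ := hex.choose_spec
  exact h.observer_unique hA hab hγ ht₁ ht₂ hJ hV h₁ t₂ right_mem_uIcc

/-- The times are unordered: taking t₁ = a gives Φ(t₂), and taking t₂ = a gives the inverse Φ(t₁)⁻¹
needed for covectors. -/
lemma transport_eq (h : nabla.IsParallelFrame γ a b ε y Φ) (hA : IsOpen A) (hab : a < b)
    (hγ : ContMDiffOn 𝓘(ℝ) 𝓘(ℝ, E) ∞ γ (Icc a b)) {t₁ t₂ : ℝ}
    (ht₁ : t₁ ∈ Ico a (a + ε)) (ht₂ : t₂ ∈ Ico a (a + ε)) :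
    nabla.transport γ a b t₁ t₂ (coordField γ a (Φ · y) t₁) =
      (tangentTriv E (γ a)).symmL ℝ (γ t₂) ∘L (Φ t₂ ∘L Ring.inverse (Φ t₁)) ∘L
        (tangentTriv E (γ a)).continuousLinearMapAt ℝ (γ t₁) := by
  have hex : ∃ L : TangentSpace 𝓘(ℝ, E) (γ t₁) →L[ℝ] TangentSpace 𝓘(ℝ, E) (γ t₂),
      ∀ w, ∃ W : ∀ t, TangentSpace 𝓘(ℝ, E) (γ t),
        nabla.IsParallelWrtObserver γ a b t₁ t₂ (coordField γ a (Φ · y) t₁) W ∧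
          W t₁ = w ∧ W t₂ = L w := by
    refine ⟨(tangentTriv E (γ a)).symmL ℝ (γ t₂) ∘L (Φ t₂ ∘L Ring.inverse (Φ t₁)) ∘L
      (tangentTriv E (γ a)).continuousLinearMapAt ℝ (γ t₁), fun w => ?_⟩
    refine ⟨coordField γ a (Φ · (Ring.inverse (Φ t₁)
      ((tangentTriv E (γ a)).continuousLinearMapAt ℝ (γ t₁) w))), ⟨_, _,
      h.isTransportInterval ht₁ ht₂, rfl, h.isParallelObserverOn hab hγ,
      h.isParallelOn hab hγ _⟩, ?_, rfl⟩
    have ht₁' := Ico_subset_Icc_self ht₁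
    have hinv : Φ t₁ (Ring.inverse (Φ t₁) ((tangentTriv E (γ a)).continuousLinearMapAt ℝ (γ t₁) w))
        = (tangentTriv E (γ a)).continuousLinearMapAt ℝ (γ t₁) w :=
      congrArg (fun L : E →L[ℝ] E => L _) (Ring.mul_inverse_cancel _ (h.isUnit t₁ ht₁'))
    rw [coordField, hinv, Trivialization.symmL_continuousLinearMapAt _ (h.mem_nhd t₁ ht₁').1]
  rw [transport, dif_pos hex]
  ext w
  obtain ⟨W, hW, hW₁, hW₂⟩ := hex.choose_spec w
  rw [← hW₂, h.parallel_unique hA hab hγ ht₁ ht₂ hW, hW₁]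
  rfl

end IsParallelFrame

end AnisotropicConnection
/-! ### Tensors in natural coordinates -/

section Pull

variable {F G H : Type*}
  [AddCommGroup F] [Module ℝ F] [TopologicalSpace F]
  [AddCommGroup G] [Module ℝ G] [TopologicalSpace G]
  [AddCommGroup H] [Module ℝ H] [TopologicalSpace H]
  {r s : ℕ}

lemma slotMap_slotMap (f : F →L[ℝ] G) (g : G →L[ℝ] F) (f' : G →L[ℝ] H) (g' : H →L[ℝ] G) :
    ∀ (i : Fin r ⊕ Fin s) (x : TensorSlot F r s i),
      slotMap f' g' i (slotMap f g i x) = slotMap (f' ∘L f) (g ∘L g') i x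
  | Sum.inl _, _ => rfl
  | Sum.inr _, _ => rfl

lemma slotMap_id : ∀ (i : Fin r ⊕ Fin s) (x : TensorSlot F r s i),
    slotMap (ContinuousLinearMap.id ℝ F) (ContinuousLinearMap.id ℝ F) i x = x
  | Sum.inl _, _ => rfl
  | Sum.inr _, _ => rfl

lemma Tensor.pull_apply (f : F →L[ℝ] G) (g : G →L[ℝ] F) (T : Tensor G r s)
    (m : ∀ i, TensorSlot F r s i) : T.pull f g m = T fun i => slotMap f g i (m i) := rfl

lemma Tensor.pull_pull (f : F →L[ℝ] G) (g : G →L[ℝ] F) (f' : G →L[ℝ] H) (g' : H →L[ℝ] G)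
    (T : Tensor H r s) : (T.pull f' g').pull f g = T.pull (f' ∘L f) (g ∘L g') := by
  ext m
  simp only [Tensor.pull_apply, slotMap_slotMap]

/-- Vectors use the first intertwining relation and covectors the second, as these are pulled back
along g. -/
lemma slotMap_slotDerivation [IsTopologicalAddGroup F] [IsTopologicalAddGroup G]
    {f : F →L[ℝ] G} {g : G →L[ℝ] F} {L : F →L[ℝ] F} {B : G →L[ℝ] G}
    (h₁ : f ∘L L = B ∘L f) (h₂ : L ∘L g = g ∘L B) :
    ∀ (i : Fin r ⊕ Fin s) (x : TensorSlot F r s i),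
      slotMap f g i (slotDerivation L i x) = slotDerivation B i (slotMap f g i x)
  | Sum.inl _, x => by
    have key : ∀ θ : F →L[ℝ] ℝ, (-(θ ∘L L)) ∘L g = -((θ ∘L g) ∘L B) := fun θ => by
      rw [ContinuousLinearMap.neg_comp, ContinuousLinearMap.comp_assoc,
        ContinuousLinearMap.comp_assoc, h₂]
    exact key x
  | Sum.inr _, x => congrArg (fun K : F →L[ℝ] G => K x) h₁

end Pull

/-! ### Derivative at the initial instant of the transported arguments -/

section TransportCalculus

variable {E : Type*} [NormedAddCommGroup E] [NormedSpace ℝ E] {r s : ℕ}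

set_option synthInstance.maxHeartbeats 200000 in
-- Inversion has differential -id at the unit, which cancels the sign of -B.
lemma HasDerivWithinAt.ringInverse_of_eq_one {R : Type*} [NormedRing R] [HasSummableGeomSeries R]
    [NormedAlgebra ℝ R] {Φ : ℝ → R} {B : R} {S : Set ℝ} {a : ℝ} (h₁ : Φ a = 1)
    (hΦ : HasDerivWithinAt Φ (-B) S a) : HasDerivWithinAt (fun t => Ring.inverse (Φ t)) B S a := by
  have h := hasFDerivAt_ringInverse (𝕜 := ℝ) (1 : Rˣ)
  rw [Units.val_one, ← h₁] at h
  refine (h.comp_hasDerivWithinAt a hΦ).congr_deriv ?_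
  simp

/-- The derivative of the action on the slots of a curve of automorphisms starting at `1`. -/
lemma hasDerivWithinAt_slotMap [CompleteSpace E] {Φ : ℝ → E →L[ℝ] E} {B : E →L[ℝ] E}
    {S : Set ℝ} {a : ℝ} (h₁ : Φ a = 1) (hΦ : HasDerivWithinAt Φ (-B) S a) :
    ∀ (i : Fin r ⊕ Fin s) (x : TensorSlot E r s i),
      HasDerivWithinAt (fun t => slotMap (Φ t) (Ring.inverse (Φ t)) i x)
        (-(slotDerivation B i x)) S a
  | Sum.inl _, x => by
    have key : ∀ θ : E →L[ℝ] ℝ,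
        HasDerivWithinAt (fun t => θ ∘L Ring.inverse (Φ t)) (-(-(θ ∘L B))) S a := fun θ => by
      rw [neg_neg]
      exact ((ContinuousLinearMap.compL ℝ E E ℝ θ).hasFDerivAt).comp_hasDerivWithinAt a
        (hΦ.ringInverse_of_eq_one h₁)
    exact key x
  | Sum.inr _, x => by
    have key : ∀ w : E, HasDerivWithinAt (fun t => Φ t w) (-(B w)) S a := fun w =>
      (hΦ.clm_apply (hasDerivWithinAt_const a S w)).congr_deriv (by simp)
    exact key x

end TransportCalculus

/-! ### Components of anisotropic tensors and their horizontal and vertical derivatives -/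

section TensorCoord

variable {E : Type*} [NormedAddCommGroup E] [NormedSpace ℝ E]
  {M : Type*} [TopologicalSpace M] [ChartedSpace E M] [IsManifold 𝓘(ℝ, E) ∞ M] {r s : ℕ}

lemma Tensor.apply_eq_inChart {p q : M} (hq : q ∈ (chartAt E p).source)
    (T : Tensor (TangentSpace 𝓘(ℝ, E) q) r s)
    (m : ∀ i, TensorSlot (TangentSpace 𝓘(ℝ, E) q) r s i) :
    T m = T.inChart p fun i => slotMap ((tangentTriv E p).continuousLinearMapAt ℝ q)
      ((tangentTriv E p).symmL ℝ q) i (m i) := by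
  have hid : (tangentTriv E p).symmL ℝ q ∘L (tangentTriv E p).continuousLinearMapAt ℝ q =
      ContinuousLinearMap.id ℝ _ :=
    ContinuousLinearMap.ext fun x => Trivialization.symmL_continuousLinearMapAt _ hq x
  simp only [Tensor.inChart, Tensor.pull_apply, slotMap_slotMap, hid, slotMap_id]

variable {A : Set (TangentBundle 𝓘(ℝ, E) M)}

/-- The components of an anisotropic tensor field in the natural coordinates around `p`. -/
def AnisotropicTensor.coord (T : AnisotropicTensor A r s) (p : M) (z : E × E) : Tensor E r s :=
  (T.toFun (coordPt p z)).inChart p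

lemma AnisotropicTensor.coord_coordOf (T : AnisotropicTensor A r s) {p : M}
    {v : TangentBundle 𝓘(ℝ, E) M} (hv : v.proj ∈ (chartAt E p).source) :
    T.coord p (coordOf p v) = (T.toFun v).inChart p := by
  rw [AnisotropicTensor.coord, coordPt_coordOf hv]

lemma AnisotropicTensor.contDiffOn_coord (T : AnisotropicTensor A r s) (p : M)
    (m : ∀ i, TensorSlot E r s i) :
    ContDiffOn ℝ ∞ (fun z => T.coord p z m) (coordDom A p) :=
  contMDiffOn_iff_contDiffOn.1 <| (T.smooth p m).comp
    ((contMDiffOn_coordPt p).mono inter_subset_left)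
    fun _ hz => ⟨hz.2, coordPt_proj_mem hz.1.1⟩

lemma AnisotropicTensor.hasFDerivAt_coord (T : AnisotropicTensor A r s) (hA : IsOpen A) {p : M}
    {z : E × E} (hz : z ∈ coordDom A p) (m : ∀ i, TensorSlot E r s i) :
    HasFDerivAt (fun z => T.coord p z m) (fderiv ℝ (fun z => T.coord p z m) z) z :=
  (((T.contDiffOn_coord p m).contDiffAt
    ((isOpen_coordDom hA p).mem_nhds hz)).differentiableAt (by simp)).hasFDerivAt

lemma AnisotropicTensor.hasDerivAt_coord_line (T : AnisotropicTensor A r s) (hA : IsOpen A)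
    {p : M} {z : E × E} (hz : z ∈ coordDom A p) (d : E × E) (m : ∀ i, TensorSlot E r s i) :
    HasDerivAt (fun τ : ℝ => T.coord p (z + τ • d) m) (fderiv ℝ (fun z => T.coord p z m) z d) 0 := by
  have hl : HasDerivAt (fun τ : ℝ => z + τ • d) d 0 := by
    simpa using ((hasDerivAt_id (0 : ℝ)).smul_const d).const_add z
  have h : HasFDerivAt (fun z => T.coord p z m) (fderiv ℝ (fun z => T.coord p z m) z)
      (z + (0 : ℝ) • d) := by
    simpa using T.hasFDerivAt_coord hA hz m
  exact h.comp_hasDerivAt (0 : ℝ) hl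

variable [FiniteDimensional ℝ E]

lemma AnisotropicTensor.deriv_coord_line (T : AnisotropicTensor A r s) (hA : IsOpen A)
    {p : M} {z : E × E} (hz : z ∈ coordDom A p) (d : E × E) (m : ∀ i, TensorSlot E r s i) :
    deriv (fun τ : ℝ => T.coord p (z + τ • d)) 0 m = fderiv ℝ (fun z => T.coord p z m) z d :=
  Tensor.deriv_apply (fun m => T.hasDerivAt_coord_line hA hz d m) m

/-- The derivative of the components along a curve, by horizontal and vertical derivatives. -/
lemma AnisotropicTensor.hasDerivWithinAt_coord (T : AnisotropicTensor A r s) (hA : IsOpen A)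
    {p : M} {c y : ℝ → E} {u w : E} {S : Set ℝ} {a : ℝ} (hmem : (c a, y a) ∈ coordDom A p)
    (hc : HasDerivWithinAt c u S a) (hy : HasDerivWithinAt y (-w) S a) :
    HasDerivWithinAt (fun t => T.coord p (c t, y t))
      (deriv (fun τ : ℝ => T.coord p ((c a, y a) + τ • (u, 0))) 0 -
        deriv (fun τ : ℝ => T.coord p ((c a, y a) + τ • (0, w))) 0) S a := by
  refine Tensor.hasDerivWithinAt_iff.2 fun m => ?_
  refine ((T.hasFDerivAt_coord hA hmem m).comp_hasDerivWithinAt a (hc.prodMk hy)).congr_deriv ?_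
  rw [sub_apply, T.deriv_coord_line hA hmem, T.deriv_coord_line hA hmem, ← map_sub]
  simp

end TensorCoord

namespace AnisotropicConnection

variable {E : Type*} [NormedAddCommGroup E] [NormedSpace ℝ E]
  {M : Type*} [TopologicalSpace M] [ChartedSpace E M] [IsManifold 𝓘(ℝ, E) ∞ M]
  {r s : ℕ} {A : Set (TangentBundle 𝓘(ℝ, E) M)}

lemma derivationTerm_apply {p : M} (T : Tensor (TangentSpace 𝓘(ℝ, E) p) r s)
    {L : TangentSpace 𝓘(ℝ, E) p →L[ℝ] TangentSpace 𝓘(ℝ, E) p} {B : E →L[ℝ] E}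
    (hLB : ∀ w, B ((tangentTriv E p).continuousLinearMapAt ℝ p w) =
      (tangentTriv E p).continuousLinearMapAt ℝ p (L w))
    (m : ∀ i, TensorSlot (TangentSpace 𝓘(ℝ, E) p) r s i) :
    T.derivationTerm L m = ∑ i, T.inChart p (Function.update
      (fun j => slotMap ((tangentTriv E p).continuousLinearMapAt ℝ p)
        ((tangentTriv E p).symmL ℝ p) j (m j)) i
      (slotDerivation B i (slotMap ((tangentTriv E p).continuousLinearMapAt ℝ p)
        ((tangentTriv E p).symmL ℝ p) i (m i)))) := by
  have hp := mem_baseSet_tangentTriv (E := E) p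
  have h₁ : (tangentTriv E p).continuousLinearMapAt ℝ p ∘L L =
      B ∘L (tangentTriv E p).continuousLinearMapAt ℝ p :=
    ContinuousLinearMap.ext fun w => (hLB w).symm
  -- Over p the trivialization is an isomorphism, so the relation between L and B can be conjugated
  -- by its inverse.
  have h₂ : L ∘L (tangentTriv E p).symmL ℝ p = (tangentTriv E p).symmL ℝ p ∘L B := by
    refine ContinuousLinearMap.ext fun x => ?_
    have h := hLB ((tangentTriv E p).symmL ℝ p x)
    rw [Trivialization.continuousLinearMapAt_symmL _ hp] at h
    rw [ContinuousLinearMap.comp_apply, ContinuousLinearMap.comp_apply, h,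
      Trivialization.symmL_continuousLinearMapAt _ hp]
  rw [Tensor.derivationTerm, sum_apply]
  refine Finset.sum_congr rfl fun i _ => ?_
  rw [ContinuousMultilinearMap.compContinuousLinearMap_apply,
    Tensor.apply_eq_inChart (mem_chart_source E p)]
  congr 1
  ext1 j
  rcases eq_or_ne j i with rfl | hij
  · rw [Function.update_self, Function.update_self, slotMap_slotDerivation h₁ h₂]
  · rw [Function.update_of_ne hij, Function.update_of_ne hij]
    rfl

variable [FiniteDimensional ℝ E] [T2Space M] (nabla : AnisotropicConnection A)

lemma christoffelCoord_self {p : M} {v : TangentSpace 𝓘(ℝ, E) p}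
    (hv : (⟨p, v⟩ : TangentBundle 𝓘(ℝ, E) M) ∈ A) (u w : TangentSpace 𝓘(ℝ, E) p) :
    nabla.christoffelCoord p (coordOf p ⟨p, v⟩)
      ((tangentTriv E p).continuousLinearMapAt ℝ p u)
      ((tangentTriv E p).continuousLinearMapAt ℝ p w) =
    (tangentTriv E p).continuousLinearMapAt ℝ p (nabla.christoffel v u w) := by
  rw [nabla.christoffelCoord_apply hv (mem_chart_source E p), ← coordExt_eq_coordFrame,
    ← coordExt_eq_coordFrame]
  rfl

/-- The parallel transport of a tensor in natural coordinates. -/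
lemma IsParallelFrame.tensorTransport_eq {nabla : AnisotropicConnection A} {γ : ℝ → M}
    {a b ε : ℝ} {y : E} {Φ : ℝ → E →L[ℝ] E}
    (h : nabla.IsParallelFrame γ a b ε y Φ) (hA : IsOpen A) (hab : a < b)
    (hγ : ContMDiffOn 𝓘(ℝ) 𝓘(ℝ, E) ∞ γ (Icc a b)) (T : AnisotropicTensor A r s) {t : ℝ}
    (ht : t ∈ Ico a (a + ε)) :
    nabla.tensorTransport T γ a b t a (coordField γ a (Φ · y) a) =
      ((T.coord (γ a) (extChartAt 𝓘(ℝ, E) (γ a) (γ t), Φ t y)).pull (Φ t)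
        (Ring.inverse (Φ t))).pull ((tangentTriv E (γ a)).continuousLinearMapAt ℝ (γ a))
          ((tangentTriv E (γ a)).symmL ℝ (γ a)) := by
  have ha : a ∈ Ico a (a + ε) := left_mem_Ico.2 (by linarith [h.pos])
  have ht' := Ico_subset_Icc_self ht
  rw [tensorTransport, h.observerTransport_eq hA hab hγ ha ht, h.transport_eq hA hab hγ ha ht,
    h.transport_eq hA hab hγ ht ha, ← h.coordOf_coordField (Φ · y) ht',
    T.coord_coordOf (h.mem_nhd t ht').1, Tensor.inChart, Tensor.pull_pull, Tensor.pull_pull,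
    h.initial, Ring.inverse_one]
  rfl

end AnisotropicConnection


end

/-! ### The derivative of the transported tensor -/

theorem mainTheorem4 {E : Type*} [NormedAddCommGroup E] [NormedSpace ℝ E] [FiniteDimensional ℝ E]
    {M : Type*} [TopologicalSpace M] [T2Space M] [ChartedSpace E M] [IsManifold 𝓘(ℝ, E) ∞ M]
    (A : Set (TangentBundle 𝓘(ℝ, E) M)) (hA_open : IsOpen A)
    (hA_conic : ∀ v ∈ A, ∀ c : ℝ, 0 < c → (⟨v.proj, c • v.2⟩ : TangentBundle 𝓘(ℝ, E) M) ∈ A)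
    (hA_proj : ∀ p : M, ∃ v ∈ A, v.proj = p)
    {r s : ℕ} (T : AnisotropicTensor A r s) (nabla : AnisotropicConnection A)
    (γ : ℝ → M) (a b : ℝ) (hab : a < b)
    (hγ : ContMDiffOn 𝓘(ℝ) 𝓘(ℝ, E) ∞ γ (Set.Icc a b))
    (hγ_regular : ∀ t ∈ Set.Icc a b, AnisotropicConnection.velocity E γ a b t ≠ 0)
    (v : TangentSpace 𝓘(ℝ, E) (γ a)) (hv : (⟨γ a, v⟩ : TangentBundle 𝓘(ℝ, E) M) ∈ A) :
    HasDerivWithinAt (fun t => nabla.tensorTransport T γ a b t a v)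
      (nabla.covDeriv T v hv (AnisotropicConnection.velocity E γ a b a)) (Set.Icc a b) a := by
  have hfin : FiniteDimensional ℝ (TangentSpace 𝓘(ℝ, E) (γ a)) :=
    inferInstanceAs (FiniteDimensional ℝ E)
  have : CompleteSpace E := FiniteDimensional.complete ℝ E
  have hsrc : γ a ∈ (chartAt E (γ a)).source := mem_chart_source E (γ a)
  have haI : a ∈ Set.Icc a b := Set.left_mem_Icc.2 hab.le
  set e := tangentTriv E (γ a) with he
  set u := AnisotropicConnection.velocity E γ a b a with hu
  set y := e.continuousLinearMapAt ℝ (γ a) v with hy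
  set B := nabla.christoffelCoord (γ a) (coordOf (γ a) ⟨γ a, v⟩)
    (e.continuousLinearMapAt ℝ (γ a) u) with hB
  have hdom : (extChartAt 𝓘(ℝ, E) (γ a) (γ a), y) ∈ coordDom A (γ a) :=
    coordOf_mem_coordDom hv hsrc
  obtain ⟨ε, Φ, hΦ⟩ := nabla.exists_isParallelFrame hA_open hab hγ hdom
  have ha : a ∈ Set.Ico a (a + ε) := Set.left_mem_Ico.2 (by linarith [hΦ.pos])
  have ha' := Set.Ico_subset_Icc_self ha
  have hva : AnisotropicConnection.coordField γ a (Φ · y) a = v := by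
    rw [AnisotropicConnection.coordField, hΦ.initial, one_apply_eq_self]
    exact Trivialization.symmL_continuousLinearMapAt _ hsrc v
  have hnhds : Set.Icc a (a + ε) ∈ 𝓝[Set.Icc a b] a := Filter.mem_of_superset
    (AnisotropicConnection.IsParallelFrame.Ico_mem_nhdsWithin ha) Set.Ico_subset_Icc_self
  have hΦ1 : ∀ w, Φ a w = w := fun w => by rw [hΦ.initial]; rfl
  have hΦ' : HasDerivWithinAt Φ (-B) (Set.Icc a b) a := by
    refine ((hΦ.deriv a ha').mono_of_mem_nhdsWithin hnhds).congr_deriv ?_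
    rw [hΦ1, hΦ.initial]
    rfl
  have hc : HasDerivWithinAt (fun t => extChartAt 𝓘(ℝ, E) (γ a) (γ t))
      (e.continuousLinearMapAt ℝ (γ a) u) (Set.Icc a b) a :=
    hasDerivWithinAt_chart_curve ((hγ a haI).mdifferentiableWithinAt (by simp)) hsrc
  have hyd : HasDerivWithinAt (fun t => Φ t y) (-(B y)) (Set.Icc a b) a :=
    (hΦ'.clm_apply (hasDerivWithinAt_const a _ y)).congr_deriv (by simp)
  have hN := T.hasDerivWithinAt_coord hA_open (p := γ a)
    (c := fun t => extChartAt 𝓘(ℝ, E) (γ a) (γ t)) (y := fun t => Φ t y)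
    (by rw [hΦ1]; exact hdom) hc hyd
  simp only [hΦ1] at hN
  refine Tensor.hasDerivWithinAt_iff.2 fun m => ?_
  set m' : ∀ i, TensorSlot E r s i := fun i => slotMap (e.continuousLinearMapAt ℝ (γ a))
    (e.symmL ℝ (γ a)) i (m i) with hm'
  have hslot := Tensor.hasDerivWithinAt_apply hN
    (fun i => hasDerivWithinAt_slotMap hΦ.initial hΦ' i (m' i))
  have hslot1 : ∀ i (x : TensorSlot E r s i), slotMap (Φ a) (Ring.inverse (Φ a)) i x = x := by
    intro i x
    rw [hΦ.initial, Ring.inverse_one]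
    exact slotMap_id i x
  -- The formula through Φ holds on [a, a + ε), which suffices for a derivative at a.
  have hev : (fun t => nabla.tensorTransport T γ a b t a v m) =ᶠ[𝓝[Set.Icc a b] a]
      fun t => T.coord (γ a) (extChartAt 𝓘(ℝ, E) (γ a) (γ t), Φ t y)
        fun i => slotMap (Φ t) (Ring.inverse (Φ t)) i (m' i) := by
    filter_upwards [AnisotropicConnection.IsParallelFrame.Ico_mem_nhdsWithin ha] with t ht
    have h := hΦ.tensorTransport_eq hA_open hab hγ T ht
    rw [hva] at h
    rw [h]
    rfl
  refine (hslot.congr_of_eventuallyEq hev (hev.eq_of_nhdsWithin haI)).congr_deriv ?_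
  simp only [hslot1, hΦ1]
  have hcoord : T.coord (γ a) (extChartAt 𝓘(ℝ, E) (γ a) (γ a), y) =
      (T.toFun ⟨γ a, v⟩).inChart (γ a) := T.coord_coordOf (v := ⟨γ a, v⟩) hsrc
  have hBapp : ∀ w, B (e.continuousLinearMapAt ℝ (γ a) w) =
      e.continuousLinearMapAt ℝ (γ a) (nabla.christoffel v u w) :=
    fun w => nabla.christoffelCoord_self hv u w
  -- By is the coordinate vector of Γ_v(u, v), so the line in the fibre over γ(a) is the coordinate
  -- line in direction (0, By).
  have hver : deriv (F := Tensor (TangentSpace 𝓘(ℝ, E) (γ a)) r s)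
      (fun τ : ℝ => T.toFun ⟨γ a, v + τ • nabla.christoffel v u v⟩) 0 m =
        deriv (fun τ : ℝ => T.coord (γ a)
        ((extChartAt 𝓘(ℝ, E) (γ a) (γ a), y) + τ • (0, B y))) 0 m' := by
    refine Tensor.deriv_apply (φ := fun k => deriv (fun τ : ℝ => T.coord (γ a)
      ((extChartAt 𝓘(ℝ, E) (γ a) (γ a), y) + τ • (0, B y))) 0 fun i =>
        slotMap (e.continuousLinearMapAt ℝ (γ a)) (e.symmL ℝ (γ a)) i (k i)) (fun k => ?_) m
    rw [T.deriv_coord_line hA_open hdom]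
    refine (T.hasDerivAt_coord_line hA_open hdom (0, B y) _).congr_of_eventuallyEq
      (Filter.Eventually.of_forall fun τ => ?_)
    have hz : (extChartAt 𝓘(ℝ, E) (γ a) (γ a), y) + τ • (0, B y) =
        coordOf (γ a) ⟨γ a, v + τ • nabla.christoffel v u v⟩ := by
      rw [hy, hBapp, ← hy]
      simp [coordOf, hy, he]
    beta_reduce
    rw [hz, T.coord_coordOf (v := ⟨γ a, v + τ • nabla.christoffel v u v⟩) hsrc]
    exact Tensor.apply_eq_inChart hsrc _ k
  -- `chartLine` and `constField` together are by definition the tangent vector with coordinates (x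
  -- + τu, y).
  have hhor : Tensor.pull (e.continuousLinearMapAt ℝ (γ a)) (e.symmL ℝ (γ a))
      (deriv (fun τ : ℝ => (T.toFun ⟨AnisotropicConnection.chartLine u τ,
        constField v (AnisotropicConnection.chartLine u τ)⟩).inChart (γ a)) 0) m =
      deriv (fun τ : ℝ => T.coord (γ a) ((extChartAt 𝓘(ℝ, E) (γ a) (γ a), y) +
        τ • (e.continuousLinearMapAt ℝ (γ a) u, 0))) 0 m' := by
    have hfun : (fun τ : ℝ => T.coord (γ a) ((extChartAt 𝓘(ℝ, E) (γ a) (γ a), y) +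
        τ • (e.continuousLinearMapAt ℝ (γ a) u, 0))) = fun τ : ℝ => T.coord (γ a)
          (extChartAt 𝓘(ℝ, E) (γ a) (γ a) + τ • e.continuousLinearMapAt ℝ (γ a) u, y) := by
      ext1 τ
      simp
    rw [hfun]
    rfl
  have hder := AnisotropicConnection.derivationTerm_apply (T.toFun ⟨γ a, v⟩)
    (L := nabla.christoffelMap v hv u) (B := B) hBapp m
  have hcov : nabla.covDeriv T v hv u m = _ - _ - _ :=
    congrArg₂ (· - ·) (congrArg₂ (· - ·) hhor hver) hder
  -- Each slot contributes the negative of `slotDerivation`; multilinearity in the updated slot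
  -- extracts the sign and matches `- derivationTerm`.
  rw [hcov, hcoord, sub_eq_add_neg _ (∑ i, _), ← Finset.sum_neg_distrib]
  refine congrArg₂ (· + ·) rfl (Finset.sum_congr rfl fun i _ => ?_)
  exact MultilinearMap.map_update_neg (ContinuousMultilinearMap.toMultilinearMap _) _ _ _
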